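/- **Conventions.** Rings are commutative with $1$. A *positive totally ordered aura* is a semifield $R$ with a total order such that $x\le z$, $y\le t$ imply $x+y\le z+t$ and $xy\le zt$, and $0<1$. It has *tempered growth* if for every non-zero $P\in\mathbb N[X]$ and $x\in R$: $x^n\le P(n)$ for all $n\in\mathbb N$ implies $x\le 1$. A *seminorm* on a ring $A$ is a map $|\cdot|:A\to R$ to such an aura with $|0|=0$, $|1|=1$, $|ab|\le|a||b|$, $|a+b|\le|a|+|b|$. Two seminorms are *multiplicatively equivalent* if $|a|_1|c|_1\le|b|_1\Leftrightarrow|a|_2|c|_2\le|b|_2$ for all $a,b,c$; a *place* is a class for this relation. $\mathrm{Speh}^m(A)$ is the set of places represented by a multiplicative seminorm with values in an aura of tempered growth. The set $M$ of multiplicative elements of $|\cdot|$ consists of the $a$ with $|a|\ne0$ and $|ab|=|a||b|$ for all $b$; $|\cdot|$ extends to $A_M$. A seminorm has *tiny balls* if the balls $B(0,|a|)=\{z:|z|<|a|\}$, $|a|>0$, form a basis of neighbourhoods of $0$ for a ring topology in the following sense: for each such ball $V$ and each $x$ there are such balls $W$ with $W+W\subset V$, with $xW\subset V$, with $WW\subset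 V$, and with $-W\subset V$. It has *multiplicatively tiny balls* if this holds for its extension to $A_M$; the separated completion of $A_M$ is then denoted $\mathcal A(x)$ (the residue field at the place $x$, when $x$ is multiplicative). A seminorm $|\cdot|$ on $A$ has a *functorial multiplicative completion* if for every ring morphism $f:B\to A$: $f(M_B)\subset M_A$; $|f(\cdot)|$ has multiplicatively tiny balls and extends, up to multiplicative equivalence, to a continuous seminorm on the completion of $B_{M_B}$; and every $f^{-1}(B(0,|a|))$, $a\in A_{M_A}$, $|a|>0$, contains some $B(0,|b|)$ with $b\in B_{M_B}$, $|b|>0$. The *analytic spectrum* $\mathrm{Speh}^a(A)\subset\mathrm{Speh}^m(A)$ is the subset of places with a functorial multiplicative completion. The topology is generated by the sets $\{x:|a(x)|<|b(x)|\}$, $a,b\in A$. For $a_1,\dots,a_n,b\in A$ let $R=R(a_1,\dots,a_n/b)\subset\mathrm{Speh}^a(A)$ be defined by: $|a_i(x)|<|b(x)|$ for all $i$, and every divisor of $b$ is multiplicative at $x$. Let $\tilde R$ be the union of $R$ and of the places satisfying the same conditions which are given by an $\mathbb R_+$-valued square-multiplicative ($|a^2|=|a|^2$) pre-archimedean ($|a+b|\le\max(|2|,1)\max(|a|,|b|)$)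 seminorm, multiplicative on the image of $\mathbb Z$, with a functorial multiplicative completion. Let $\mathcal O(\tilde R)$ be the separated completion of $A[b^{-1}]$ for the topology induced by $A[b^{-1}]\to\prod_{x\in\tilde R}\mathcal A(x)$. For $U\subset\mathrm{Speh}^a(A)$ open, an *analytic function* on $U$ is an element $f\in\prod_{x\in U}\mathcal A(x)$ such that each $x_0\in U$ lies in some $R\subset U$ as above with $f|_R$ in the image of $\mathcal O(\tilde R)\to\prod_{x\in R}\mathcal A(x)$. The ring of analytic functions on $U$ carries the topology induced by $\prod_{x\in U}\mathcal A(x)$, and the ring of germs at $x$ is the direct limit of these rings over the open $U\ni x$. On $\mathbb Z$, for $p$ prime, let $|n|_{p,0}=0$ if $p\mid n$ and $1$ otherwise, let $|\cdot|_p$ be the $p$-adic norm, $|\cdot|_\infty$ the usual absolute value, and $|\cdot|_0$ the trivial norm ($|n|_0=1$ for $n\ne0$). **Proposition (the analytic spectrum of $\mathbb Z$).** 1. $\mathrm{Speh}^a(\mathbb Z)=\mathrm{Speh}^m(\mathbb Z)$, and its points are the places $|\cdot|_0$, $|\cdot|_\infty$, and $|\cdot|_p$, $|\cdot|_{p,0}$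 for $p$ prime. 2. The residue field $\mathcal A(x)$ (as a topological ring) and the ring of germs of analytic functions at $x$ (as a ring) are isomorphic to: $\mathbb F_p$ and $\mathbb Z_p$ if $x=|\cdot|_{p,0}$; $\mathbb Q_p$ and $\mathbb Q_p$ if $x=|\cdot|_p$; $\mathbb R$ and $\mathbb R$ if $x=|\cdot|_\infty$; $\mathbb Q$ and $\mathbb Q$ if $x=|\cdot|_0$. Here $\mathbb F_p$ and the residue field $\mathbb Q$ at $|\cdot|_0$ are discrete. 3. For every integer $m\ne0$, the ring of analytic functions on $\{x:0<|m(x)|\}$ is isomorphic to $\mathbb Z[1/m]$ and its topology is discrete; the same holds for the ring of analytic series $\mathcal O(\tilde R)$ with $R=R(0/m)=\{x:0<|m(x)|\}$. 4. In particular, the ring of global analytic functions on $\mathrm{Speh}^a(\mathbb Z)$ is isomorphic to $\mathbb Z$, with the discrete topology. -/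

import Mathlib

open scoped NNReal Topology

/-! ### Positive totally ordered auras and generalized seminorms -/

/-- A positive totally ordered aura: a semifield with a total order such that `x ≤ z` and `y ≤ t`
imply `x + y ≤ z + t` and `x * y ≤ z * t`, and such that `0 < 1`. -/
class IsPositiveAura (R : Type*) [Semifield R] [LinearOrder R] : Prop where
  add_le_add : ∀ x y z t : R, x ≤ z → y ≤ t → x + y ≤ z + t
  mul_le_mul : ∀ x y z t : R, x ≤ z → y ≤ t → x * y ≤ z * t
  zero_lt_one : (0 : R) < 1

instance IsPositiveAura.instNNReal : IsPositiveAura ℝ≥0 where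
  add_le_add _ _ _ _ h k := _root_.add_le_add h k
  mul_le_mul _ _ _ _ h k := mul_le_mul' h k
  zero_lt_one := one_pos

theorem IsPositiveAura.zero_le {R : Type*} [Semifield R] [LinearOrder R] [IsPositiveAura R]
    (x : R) : 0 ≤ x := by
  simpa using IsPositiveAura.mul_le_mul (0 : R) x 1 x IsPositiveAura.zero_lt_one.le le_rfl

/-- `R` has tempered growth: for every non-zero `P ∈ ℕ[X]`, if `x ^ n ≤ P(n)` in `R` for all `n`,
then `x ≤ 1`. -/
def HasTemperedGrowth (R : Type*) [Semifield R] [LinearOrder R] : Prop :=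
  ∀ P : Polynomial ℕ, P ≠ 0 → ∀ x : R, (∀ n : ℕ, x ^ n ≤ ((P.eval n : ℕ) : R)) → x ≤ 1

/-- A generalized seminorm on the ring `A` with values in `R`. -/
structure GSeminorm (A : Type*) [CommRing A] (R : Type*) [Semifield R] [LinearOrder R] where
  toFun : A → R
  map_one : toFun 1 = 1
  map_zero : toFun 0 = 0
  map_mul_le : ∀ a b, toFun (a * b) ≤ toFun a * toFun b
  map_add_le : ∀ a b, toFun (a + b) ≤ toFun a + toFun b

namespace GSeminorm

universe u

section Basic

variable {A : Type*} [CommRing A] {R : Type*} [Semifield R] [LinearOrder R]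

instance : CoeFun (GSeminorm A R) (fun _ => A → R) := ⟨GSeminorm.toFun⟩

def IsMultiplicative (v : GSeminorm A R) : Prop := ∀ a b, v (a * b) = v a * v b

def IsSquareMultiplicative (v : GSeminorm A R) : Prop := ∀ a, v (a ^ 2) = v a ^ 2

def IsPreArchimedean (v : GSeminorm A R) : Prop :=
  ∀ a b, v (a + b) ≤ max (v 2) 1 * max (v a) (v b)

/-- The restriction of the seminorm to (the image of) `ℤ` is multiplicative. -/
def IsIntMultiplicative (v : GSeminorm A R) : Prop :=
  ∀ m n : ℤ, v ((m : A) * (n : A)) = v (m : A) * v (n : A)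

/-- Multiplicative equivalence of two seminorms (each is multiplicatively bounded by the other). -/
def MulEquivalent {S : Type*} [Semifield S] [LinearOrder S]
    (v : GSeminorm A R) (w : GSeminorm A S) : Prop :=
  ∀ a b c, w a * w c ≤ w b ↔ v a * v c ≤ v b

/-- The seminorm `|f(.)|` on `B`, for a ring morphism `f : B → A`. -/
def comap (v : GSeminorm A R) {B : Type*} [CommRing B] (f : B →+* A) : GSeminorm B R where
  toFun b := v (f b)
  map_one := by rw [f.map_one, v.map_one]
  map_zero := by rw [f.map_zero, v.map_zero]
  map_mul_le a b := by rw [f.map_mul]; exact v.map_mul_le _ _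
  map_add_le a b := by rw [f.map_add]; exact v.map_add_le _ _

/-- The set `M` of multiplicative elements of a seminorm. -/
def mulElts (v : GSeminorm A R) : Submonoid A where
  carrier := {a | IsUnit (v a) ∧ ∀ b, v (a * b) = v a * v b}
  one_mem' := ⟨by rw [v.map_one]; exact isUnit_one, fun b => by rw [v.map_one, one_mul, one_mul]⟩
  mul_mem' := by
    rintro a b ⟨ha, ha'⟩ ⟨hb, hb'⟩
    refine ⟨by rw [ha']; exact ha.mul hb, fun c => ?_⟩
    rw [mul_assoc, ha', hb', ha', mul_assoc]

theorem mem_mulElts {v : GSeminorm A R} {a : A} :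
    a ∈ v.mulElts ↔ IsUnit (v a) ∧ ∀ b, v (a * b) = v a * v b := Iff.rfl

/-- The extension `|a / s| = |a| / |s|` of a seminorm to the localization `A_M` of `A` at its
multiplicative elements. -/
def localize [IsPositiveAura R] (v : GSeminorm A R) : GSeminorm (Localization v.mulElts) R where
  toFun q := q.liftOn (fun a s => v a / v (s : A)) (by
    intro a c b d h
    obtain ⟨e, he⟩ := Localization.r_iff_exists.1 h
    have h1 : v ((e : A) * ((d : A) * a)) = v ((e : A) * ((b : A) * c)) := by rw [he]
    rw [e.2.2, e.2.2, d.2.2, b.2.2] at h1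
    have h2 := mul_left_cancel₀ e.2.1.ne_zero h1
    rw [div_eq_div_iff b.2.1.ne_zero d.2.1.ne_zero, mul_comm, h2, mul_comm])
  map_one := by
    rw [← Localization.mk_one, Localization.liftOn_mk]
    simp [v.map_one]
  map_zero := by
    rw [← Localization.mk_zero (1 : v.mulElts), Localization.liftOn_mk, v.map_zero, zero_div]
  map_mul_le p q := by
    induction p with | H p => ?_
    induction q with | H q => ?_
    obtain ⟨a, s⟩ := p
    obtain ⟨b, t⟩ := q
    rw [Localization.mk_mul, Localization.liftOn_mk, Localization.liftOn_mk,
      Localization.liftOn_mk, Submonoid.coe_mul, s.2.2, div_mul_div_comm, div_eq_mul_inv,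
      div_eq_mul_inv]
    exact IsPositiveAura.mul_le_mul _ _ _ _ (v.map_mul_le _ _) le_rfl
  map_add_le p q := by
    induction p with | H p => ?_
    induction q with | H q => ?_
    obtain ⟨a, s⟩ := p
    obtain ⟨b, t⟩ := q
    rw [Localization.add_mk, Localization.liftOn_mk, Localization.liftOn_mk,
      Localization.liftOn_mk, Submonoid.coe_mul, s.2.2,
      div_add_div _ _ s.2.1.ne_zero t.2.1.ne_zero, div_eq_mul_inv, div_eq_mul_inv]
    refine IsPositiveAura.mul_le_mul _ _ _ _ ?_ le_rfl
    refine (v.map_add_le _ _).trans (le_of_eq ?_)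
    rw [s.2.2, t.2.2, add_comm, mul_comm (v a)]

theorem localize_mk [IsPositiveAura R] (v : GSeminorm A R) (a : A) (s : v.mulElts) :
    v.localize (Localization.mk a s) = v a / v (s : A) := rfl

/-- The open ball `B(x, |a|) = {z | |z - x| < |a|}` (only used for `|a| > 0`). -/
def ball (v : GSeminorm A R) (x a : A) : Set A := {z | v (z - x) < v a}

/-- The conditions under which the balls `B(0, |a|)`, `|a| > 0`, are a basis of neighbourhoods of
zero for a ring topology. -/
structure HasTinyBalls (v : GSeminorm A R) : Prop where
  add : ∀ a, 0 < v a → ∃ a', 0 < v a' ∧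
    ∀ y ∈ v.ball 0 a', ∀ z ∈ v.ball 0 a', y + z ∈ v.ball 0 a
  mul_left : ∀ a, 0 < v a → ∀ x, ∃ c, 0 < v c ∧ ∀ z ∈ v.ball 0 c, x * z ∈ v.ball 0 a
  mul : ∀ a, 0 < v a → ∃ a', 0 < v a' ∧
    ∀ y ∈ v.ball 0 a', ∀ z ∈ v.ball 0 a', y * z ∈ v.ball 0 a
  neg : ∀ a, 0 < v a → ∃ a', 0 < v a' ∧ ∀ z ∈ v.ball 0 a', -z ∈ v.ball 0 a

/-- The balls `B(0, |a|)`, `|a| > 0`, as a basis of neighbourhoods of zero of a ring topology. -/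
abbrev HasTinyBalls.ringFilterBasis [IsPositiveAura R] {v : GSeminorm A R}
    (h : v.HasTinyBalls) : RingFilterBasis A where
  sets := {U | ∃ a, 0 < v a ∧ U = v.ball 0 a}
  nonempty := ⟨_, 1, by rw [v.map_one]; exact IsPositiveAura.zero_lt_one, rfl⟩
  inter_sets := by
    rintro _ _ ⟨a, ha, rfl⟩ ⟨b, hb, rfl⟩
    rcases le_total (v a) (v b) with hab | hab
    · exact ⟨_, ⟨a, ha, rfl⟩, fun z hz => ⟨hz, lt_of_lt_of_le hz hab⟩⟩
    · exact ⟨_, ⟨b, hb, rfl⟩, fun z hz => ⟨lt_of_lt_of_le hz hab, hz⟩⟩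
  zero' := by
    rintro _ ⟨a, ha, rfl⟩
    simpa [ball, v.map_zero] using ha
  add' := by
    rintro _ ⟨a, ha, rfl⟩
    obtain ⟨b, hb, hb'⟩ := h.add a ha
    refine ⟨_, ⟨b, hb, rfl⟩, ?_⟩
    rintro _ ⟨y, hy, z, hz, rfl⟩
    exact hb' y hy z hz
  neg' := by
    rintro _ ⟨a, ha, rfl⟩
    obtain ⟨b, hb, hb'⟩ := h.neg a ha
    exact ⟨_, ⟨b, hb, rfl⟩, hb'⟩
  conj' := by
    rintro x _ ⟨a, ha, rfl⟩
    refine ⟨_, ⟨a, ha, rfl⟩, fun z hz => ?_⟩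
    simpa using hz
  mul' := by
    rintro _ ⟨a, ha, rfl⟩
    obtain ⟨b, hb, hb'⟩ := h.mul a ha
    refine ⟨_, ⟨b, hb, rfl⟩, ?_⟩
    rintro _ ⟨y, hy, z, hz, rfl⟩
    exact hb' y hy z hz
  mul_left' := by
    rintro x _ ⟨a, ha, rfl⟩
    obtain ⟨b, hb, hb'⟩ := h.mul_left a ha x
    exact ⟨_, ⟨b, hb, rfl⟩, hb'⟩
  mul_right' := by
    rintro x _ ⟨a, ha, rfl⟩
    obtain ⟨b, hb, hb'⟩ := h.mul_left a ha x
    refine ⟨_, ⟨b, hb, rfl⟩, fun z hz => ?_⟩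
    have := hb' z hz
    rwa [mul_comm] at this

end Basic

section Completion

variable {A : Type*} [CommRing A] {R : Type*} [Semifield R] [LinearOrder R] [IsPositiveAura R]

/-- The ring `A` with the ball neighbourhood topology of a seminorm with tiny balls. -/
def BallRing (v : GSeminorm A R) (_h : v.HasTinyBalls) : Type _ := A

variable (v : GSeminorm A R) (h : v.HasTinyBalls)

instance : CommRing (BallRing v h) := inferInstanceAs (CommRing A)

instance : TopologicalSpace (BallRing v h) := h.ringFilterBasis.topology

instance : IsTopologicalRing (BallRing v h) := h.ringFilterBasis.isTopologicalRing

instance : UniformSpace (BallRing v h) :=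
  IsTopologicalAddGroup.rightUniformSpace (BallRing v h)

instance : IsUniformAddGroup (BallRing v h) := isUniformAddGroup_of_addCommGroup

/-- The separated completion of `A` for the ring topology defined by the seminorm. -/
abbrev SepCompletion : Type _ := UniformSpace.Completion (BallRing v h)

/-- The canonical map from `A` to its separated completion. -/
noncomputable def toSepCompletion : A →+* SepCompletion v h :=
  (UniformSpace.Completion.coeRingHom : BallRing v h →+* SepCompletion v h)

/-- The seminorm has multiplicatively tiny balls. -/
abbrev HasMulTinyBalls : Prop := v.localize.HasTinyBalls

end Completion

section Functorial

variable {A : Type u} [CommRing A] {R : Type u} [Semifield R] [LinearOrder R] [IsPositiveAura R]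

/-- The seminorm (up to multiplicative equivalence) extends to a continuous seminorm
on the separated completion. -/
def ExtendsToCompletion (v : GSeminorm A R) (h : v.HasTinyBalls) : Prop :=
  ∃ (S : Type u) (_ : Semifield S) (_ : LinearOrder S) (_ : IsPositiveAura S)
    (w : GSeminorm (SepCompletion v h) S),
    v.MulEquivalent (w.comap (toSepCompletion v h)) ∧
    ∀ z, 0 < w z → w.ball 0 z ∈ 𝓝 (0 : SepCompletion v h)

/-- The seminorm has a functorial multiplicative completion. -/
def HasFunctorialMulCompletion (v : GSeminorm A R) : Prop :=
  ∀ (B : Type u) [CommRing B] (f : B →+* A),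
    ∃ (h₁ : (v.comap f).mulElts ≤ v.mulElts.comap f) (h₂ : (v.comap f).HasMulTinyBalls),
      (v.comap f).localize.ExtendsToCompletion h₂ ∧
      ∀ a : Localization v.mulElts, 0 < v.localize a →
        ∃ b : Localization (v.comap f).mulElts, 0 < (v.comap f).localize b ∧
          (v.comap f).localize.ball 0 b ⊆
            (IsLocalization.map (Localization v.mulElts) f h₁ :
              Localization (v.comap f).mulElts →+* Localization v.mulElts) ⁻¹'
                v.localize.ball 0 a

theorem HasFunctorialMulCompletion.hasMulTinyBalls {v : GSeminorm A R}
    (h : v.HasFunctorialMulCompletion) : v.HasMulTinyBalls :=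
  (h A (RingHom.id A)).2.1

end Functorial

end GSeminorm

/-! ### Places and harmonious spectra -/

universe u

/-- A generalized seminorm together with its positive totally ordered aura of values. -/
structure BundledSeminorm (A : Type u) [CommRing A] : Type (u + 1) where
  R : Type u
  [semifield : Semifield R]
  [linearOrder : LinearOrder R]
  [aura : IsPositiveAura R]
  val : GSeminorm A R

attribute [instance] BundledSeminorm.semifield BundledSeminorm.linearOrder BundledSeminorm.aura

instance BundledSeminorm.setoid (A : Type u) [CommRing A] : Setoid (BundledSeminorm A) where
  r v w := v.val.MulEquivalent w.val
  iseqv := ⟨fun _ _ _ _ => Iff.rfl, fun h a b c => (h a b c).symm,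
    fun h k a b c => (k a b c).trans (h a b c)⟩

/-- A place of `A`: a multiplicative equivalence class of generalized seminorms. (A seminorm on
`A : Type u` is equivalent to one with values in the sub-semifield generated by its image, so that
auras of values in `Type u` suffice, and tempered growth passes to sub-semifields.) -/
def Place (A : Type u) [CommRing A] : Type (u + 1) := Quotient (BundledSeminorm.setoid A)

/-- The place defined by a seminorm. -/
def GSeminorm.place {A : Type u} [CommRing A] {R : Type u} [Semifield R] [LinearOrder R]
    [IsPositiveAura R] (v : GSeminorm A R) : Place A := Quotient.mk _ ⟨R, v⟩

namespace Place

variable {A : Type u} [CommRing A]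

/-- The aura of values of a chosen representative of the place `x`. -/
abbrev Values (x : Place A) : Type u := (Quotient.out x).R

/-- A chosen representative `|.(x)|` of the place `x`. -/
noncomputable def norm (x : Place A) : GSeminorm A x.Values := (Quotient.out x).val

theorem place_norm (x : Place A) : x.norm.place = x := Quotient.out_eq x

end Place

section Spectra

variable (A : Type u) [CommRing A]

/-- The multiplicative harmonious spectrum: the set of tempered multiplicative places. -/
def SpehM : Set (Place A) :=
  {x | ∃ v : BundledSeminorm A, v.val.place = x ∧ v.val.IsMultiplicative ∧ HasTemperedGrowth v.R}

/-- The pre-archimedean square-multiplicative harmonious spectrum. -/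
def SpehPasm : Set (Place A) :=
  {x | ∃ v : BundledSeminorm A, v.val.place = x ∧
    v.val.IsPreArchimedean ∧ v.val.IsSquareMultiplicative}

/-- The analytic spectrum: the places in `SpehM A` which have a functorial multiplicative
completion. -/
def SpehA : Set (Place A) := {x ∈ SpehM A | x.norm.HasFunctorialMulCompletion}

variable {A}

/-- The condition `|a(x)| < |b(x)|` for all `a` in the list `l`, and `d ∣ b` implies that `d` is
multiplicative for `|.(x)|`. -/
def Place.InRational (x : Place A) (l : List A) (b : A) : Prop :=
  (∀ a ∈ l, x.norm a < x.norm b) ∧ ∀ d, d ∣ b → d ∈ x.norm.mulElts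

/-- The topology generated by the sets `U(a / b)`; every harmonious spectrum carries the induced
topology. -/
instance Place.instTopologicalSpace : TopologicalSpace (Place A) :=
  TopologicalSpace.generateFrom {U | ∃ a b : A, U = {x | x.InRational [a] b}}

/-- The open rational subset `R(a₁, …, aₙ / b)` of the analytic spectrum. -/
def rationalDomain (l : List A) (b : A) : Set (SpehA A) := {x | x.1.InRational l b}

/-- The value ring `𝒜(x)` (multiplicative completion) at a place `x` with a functorial
multiplicative completion. -/
abbrev ValueRing (x : Place A) (h : x.norm.HasFunctorialMulCompletion) : Type u :=
  x.norm.localize.SepCompletion h.hasMulTinyBalls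

/-- The residue field `𝒜(x)` at a point `x` of the analytic spectrum. -/
abbrev ResidueField (x : SpehA A) : Type u := ValueRing x.1 x.2.2

/-- The set `R̃` associated to `R = R(a₁, …, aₙ / b)`: besides the points of `R`, it contains the
pre-archimedean square-multiplicative places satisfying the inequalities that define `R` which are
given by `ℝ₊`-valued square-multiplicative seminorms, have a functorial multiplicative completion
and are `ℤ`-multiplicative. -/
def rationalTilde (l : List A) (b : A) : Set (Place A) :=
  {x | x.InRational l b ∧ (x ∈ SpehA A ∨
    (x ∈ SpehPasm A ∧
      (∃ v : GSeminorm A ℝ≥0, v.IsSquareMultiplicative ∧ v.MulEquivalent x.norm) ∧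
      x.norm.HasFunctorialMulCompletion ∧ x.norm.IsIntMultiplicative))}

end Spectra

/-! ### Analytic series and analytic functions -/

section Analytic

variable {A : Type u} [CommRing A]

theorem rationalTilde.functorial {l : List A} {b : A} {x : Place A} (hx : x ∈ rationalTilde l b) :
    x.norm.HasFunctorialMulCompletion := by
  rcases hx.2 with h | h
  · exact h.2
  · exact h.2.2.1

/-- The canonical map `A → 𝒜(x)`. -/
noncomputable def toValueRing (x : Place A) (h : x.norm.HasFunctorialMulCompletion) :
    A →+* ValueRing x h :=
  (x.norm.localize.toSepCompletion h.hasMulTinyBalls).comp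
    (algebraMap A (Localization x.norm.mulElts))

theorem isUnit_toValueRing (x : Place A) (h : x.norm.HasFunctorialMulCompletion) {b : A}
    (hb : b ∈ x.norm.mulElts) : IsUnit (toValueRing x h b) :=
  (IsLocalization.map_units (Localization x.norm.mulElts) (⟨b, hb⟩ : x.norm.mulElts)).map
    (x.norm.localize.toSepCompletion h.hasMulTinyBalls)

/-- The canonical map `A[b⁻¹] → 𝒜(x)` for `b` multiplicative at `x`. -/
noncomputable def awayToValueRing (x : Place A) (h : x.norm.HasFunctorialMulCompletion) (b : A)
    (hb : b ∈ x.norm.mulElts) : Localization.Away b →+* ValueRing x h :=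
  IsLocalization.Away.lift b (isUnit_toValueRing x h hb)

/-- The canonical map from `A[b⁻¹]` to the product of the `𝒜(x)` for `x` in `R̃`. -/
noncomputable def awayToProd (l : List A) (b : A) :
    Localization.Away b →+*
      ∀ x : rationalTilde l b, ValueRing x.1 (rationalTilde.functorial x.2) :=
  RingHom.pi fun x => awayToValueRing x.1 _ b (x.2.1.2 b dvd_rfl)

/-- The ring `A[b⁻¹]`, with the topology induced by its map to the product of the `𝒜(x)` for
`x` in `R̃`. -/
def PreSeries (_l : List A) (b : A) : Type u := Localization.Away b

instance (l : List A) (b : A) : CommRing (PreSeries l b) :=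
  inferInstanceAs (CommRing (Localization.Away b))

/-- `awayToProd` on the topologized ring. -/
noncomputable def PreSeries.toProd (l : List A) (b : A) :
    PreSeries l b →+* ∀ x : rationalTilde l b, ValueRing x.1 (rationalTilde.functorial x.2) :=
  awayToProd l b

noncomputable instance (l : List A) (b : A) : TopologicalSpace (PreSeries l b) :=
  TopologicalSpace.induced (PreSeries.toProd l b) inferInstance

theorem PreSeries.continuous_toProd (l : List A) (b : A) : Continuous (PreSeries.toProd l b) :=
  continuous_induced_dom

instance (l : List A) (b : A) : IsTopologicalRing (PreSeries l b) where
  toContinuousAdd := continuousAdd_induced (PreSeries.toProd l b)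
  toContinuousMul := continuousMul_induced (PreSeries.toProd l b)
  continuous_neg := continuous_induced_rng.2 (by
    have h : (PreSeries.toProd l b) ∘ (fun a => -a) = fun a => -(PreSeries.toProd l b a) := by
      funext a
      exact map_neg _ a
    rw [h]
    exact (PreSeries.continuous_toProd l b).neg)

noncomputable instance (l : List A) (b : A) : UniformSpace (PreSeries l b) :=
  IsTopologicalAddGroup.rightUniformSpace (PreSeries l b)

instance (l : List A) (b : A) : IsUniformAddGroup (PreSeries l b) :=
  isUniformAddGroup_of_addCommGroup

/-- The ring of analytic series on `R̃`: the completion of `A[b⁻¹]`. -/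
abbrev AnalyticSeries (l : List A) (b : A) : Type u := UniformSpace.Completion (PreSeries l b)

theorem PreSeries.continuous_coord (l : List A) (b : A) (x : rationalTilde l b) :
    Continuous ((Pi.evalRingHom
      (fun x : rationalTilde l b => ValueRing x.1 (rationalTilde.functorial x.2)) x).comp
        (PreSeries.toProd l b)) :=
  (continuous_apply x).comp (PreSeries.continuous_toProd l b)

/-- The value of an analytic series at a point of `R̃`. -/
noncomputable def AnalyticSeries.eval (l : List A) (b : A) (x : rationalTilde l b) :
    AnalyticSeries l b →+* ValueRing x.1 (rationalTilde.functorial x.2) :=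
  UniformSpace.Completion.extensionHom _ (PreSeries.continuous_coord l b x)

theorem mem_rationalTilde {l : List A} {b : A} {x : SpehA A} (hx : x ∈ rationalDomain l b) :
    x.1 ∈ rationalTilde l b := ⟨hx, Or.inl x.2⟩

/-- The rule `f` on `U` is analytic: around every point `x₀` of `U` there is a rational domain
`R ∋ x₀` contained in `U` such that `f` restricted to `R` comes from an analytic series on `R̃`. -/
def IsAnalyticOn (U : Set (SpehA A)) (f : ∀ x : U, ResidueField x.1) : Prop :=
  ∀ x₀ ∈ U, ∃ (l : List A) (b : A) (hR : rationalDomain l b ⊆ U), x₀ ∈ rationalDomain l b ∧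
    ∃ g : AnalyticSeries l b, ∀ (x : SpehA A) (hx : x ∈ rationalDomain l b),
      f ⟨x, hR hx⟩ = AnalyticSeries.eval l b ⟨x.1, mem_rationalTilde hx⟩ g

theorem GSeminorm.IsMultiplicative.mem_mulElts {R : Type*} [Semifield R] [LinearOrder R]
    {v : GSeminorm A R} (hv : v.IsMultiplicative) {a : A} : a ∈ v.mulElts ↔ v a ≠ 0 :=
  ⟨fun h => h.1.ne_zero, fun h => ⟨isUnit_iff_ne_zero.2 h, hv a⟩⟩

theorem SpehM.isMultiplicative {x : Place A} (hx : x ∈ SpehM A) : x.norm.IsMultiplicative := by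
  obtain ⟨v, hv, hm, -⟩ := hx
  have h : v.val.MulEquivalent x.norm := Quotient.exact (hv.trans x.place_norm.symm)
  exact fun a b => le_antisymm (x.norm.map_mul_le a b) ((h a (a * b) b).2 (hm a b).ge)

theorem SpehM.inRational_iff {x : Place A} (hx : x ∈ SpehM A) {l : List A} {b : A} :
    x.InRational l b ↔ (∀ a ∈ l, x.norm a < x.norm b) ∧ x.norm b ≠ 0 := by
  have hm := SpehM.isMultiplicative hx
  refine and_congr_right fun _ => ⟨fun h => (h b dvd_rfl).1.ne_zero, fun h d hd => ?_⟩
  rw [hm.mem_mulElts]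
  rintro h0
  obtain ⟨e, rfl⟩ := hd
  exact h (by rw [hm, h0, zero_mul])

theorem IsPositiveAura.lt_of_mul_lt {R : Type*} [Semifield R] [LinearOrder R] [IsPositiveAura R]
    {x y z : R} (h : z * x < z * y) : x < y :=
  lt_of_not_ge fun hyx => h.not_ge (IsPositiveAura.mul_le_mul _ _ _ _ le_rfl hyx)

theorem IsPositiveAura.mul_lt_mul {R : Type*} [Semifield R] [LinearOrder R] [IsPositiveAura R]
    {x y z : R} (hz : z ≠ 0) (h : x < y) : z * x < z * y :=
  lt_of_le_of_ne (IsPositiveAura.mul_le_mul _ _ _ _ le_rfl h.le)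
    fun he => h.ne (mul_left_cancel₀ hz he)

/-- The list defining the intersection of two rational domains. -/
def interList (l₁ : List A) (b₁ : A) (l₂ : List A) (b₂ : A) : List A :=
  l₁.map (fun a => b₂ * a) ++ l₂.map (fun a => b₁ * a)

theorem Place.InRational.of_inter {x : Place A} {l₁ l₂ : List A} {b₁ b₂ : A}
    (h : x.InRational (interList l₁ b₁ l₂ b₂) (b₁ * b₂)) :
    x.InRational l₁ b₁ ∧ x.InRational l₂ b₂ := by
  have hb₁ := h.2 b₁ (dvd_mul_right _ _)
  have hb₂ := h.2 b₂ (dvd_mul_left _ _)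
  refine ⟨⟨fun a ha => ?_, fun d hd => h.2 d (hd.mul_right _)⟩,
    ⟨fun a ha => ?_, fun d hd => h.2 d (hd.mul_left _)⟩⟩
  · have := h.1 (b₂ * a) (List.mem_append_left _ (List.mem_map_of_mem ha))
    rw [mul_comm b₁, hb₂.2, hb₂.2] at this
    exact IsPositiveAura.lt_of_mul_lt this
  · have := h.1 (b₁ * a) (List.mem_append_right _ (List.mem_map_of_mem ha))
    rw [hb₁.2, hb₁.2] at this
    exact IsPositiveAura.lt_of_mul_lt this

theorem rationalTilde_inter_left (l₁ l₂ : List A) (b₁ b₂ : A) :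
    rationalTilde (interList l₁ b₁ l₂ b₂) (b₁ * b₂) ⊆ rationalTilde l₁ b₁ :=
  fun _ hx => ⟨hx.1.of_inter.1, hx.2⟩

theorem rationalTilde_inter_right (l₁ l₂ : List A) (b₁ b₂ : A) :
    rationalTilde (interList l₁ b₁ l₂ b₂) (b₁ * b₂) ⊆ rationalTilde l₂ b₂ :=
  fun _ hx => ⟨hx.1.of_inter.2, hx.2⟩

theorem rationalDomain_inter (l₁ l₂ : List A) (b₁ b₂ : A) :
    rationalDomain (interList l₁ b₁ l₂ b₂) (b₁ * b₂) =
      rationalDomain l₁ b₁ ∩ rationalDomain l₂ b₂ := by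
  ext x
  refine ⟨fun h => ?_, fun h => ?_⟩
  · exact Place.InRational.of_inter (x := x.1) h
  · have h₁ := (SpehM.inRational_iff x.2.1).1 h.1
    have h₂ := (SpehM.inRational_iff x.2.1).1 h.2
    have hm := SpehM.isMultiplicative x.2.1
    refine (SpehM.inRational_iff x.2.1).2 ⟨fun a ha => ?_, ?_⟩
    · rcases List.mem_append.1 ha with ha | ha
      · obtain ⟨c, hc, rfl⟩ := List.mem_map.1 ha
        rw [mul_comm b₁, hm, hm]
        exact IsPositiveAura.mul_lt_mul h₂.2 (h₁.1 c hc)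
      · obtain ⟨c, hc, rfl⟩ := List.mem_map.1 ha
        rw [hm, hm]
        exact IsPositiveAura.mul_lt_mul h₁.2 (h₂.1 c hc)
    · rw [hm]
      exact mul_ne_zero h₁.2 h₂.2

theorem isOpen_rationalDomain (l : List A) (b : A) : IsOpen (rationalDomain l b) := by
  have key : ∀ a b : A, IsOpen (rationalDomain [a] b) := fun a b => by
    have h : IsOpen {x : Place A | x.InRational [a] b} :=
      TopologicalSpace.isOpen_generateFrom_of_mem ⟨a, b, rfl⟩
    exact h.preimage continuous_subtype_val
  have h : rationalDomain l b =
      rationalDomain [0] b ∩ ⋂ a ∈ {a | a ∈ l}, rationalDomain [a] b := by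
    ext x
    have e : ∀ l : List A, x ∈ rationalDomain l b ↔
        (∀ a ∈ l, x.1.norm a < x.1.norm b) ∧ x.1.norm b ≠ 0 :=
      fun l => SpehM.inRational_iff x.2.1
    simp only [Set.mem_inter_iff, Set.mem_iInter, Set.mem_ofPred_eq, e, List.mem_singleton,
      forall_eq, x.1.norm.map_zero]
    refine ⟨fun h => ⟨⟨lt_of_le_of_ne (IsPositiveAura.zero_le _) h.2.symm, h.2⟩,
      fun a ha => ⟨h.1 a ha, h.2⟩⟩, fun h => ⟨fun a ha => (h.2 a ha).1, h.1.2⟩⟩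
  rw [h]
  exact (key 0 b).inter (l.finite_toSet.isOpen_biInter fun a _ => key a b)

theorem exists_rationalDomain_subset {U : Set (SpehA A)} (hU : IsOpen U) {x : SpehA A}
    (hx : x ∈ U) : ∃ (l : List A) (b : A), x ∈ rationalDomain l b ∧ rationalDomain l b ⊆ U := by
  obtain ⟨V, hV, rfl⟩ := isOpen_induced_iff.1 hU
  change x.1 ∈ V at hx
  have pre : ∀ W : Set (Place A), TopologicalSpace.GenerateOpen
      {U | ∃ a b : A, U = {x | x.InRational [a] b}} W →
      IsOpen ((↑) ⁻¹' W : Set (SpehA A)) := fun W hW =>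
    IsOpen.preimage continuous_subtype_val (show IsOpen W from hW)
  induction hV with
  | basic s hs =>
    obtain ⟨a, b, rfl⟩ := hs
    exact ⟨[a], b, hx, fun y hy => hy⟩
  | univ =>
    refine ⟨[], 1, (SpehM.inRational_iff x.2.1).2 ⟨by simp, ?_⟩, fun y _ => trivial⟩
    rw [x.1.norm.map_one]
    exact one_ne_zero
  | inter s t hs ht ihs iht =>
    obtain ⟨l₁, b₁, h₁, k₁⟩ := ihs (pre s hs) hx.1
    obtain ⟨l₂, b₂, h₂, k₂⟩ := iht (pre t ht) hx.2
    refine ⟨interList l₁ b₁ l₂ b₂, b₁ * b₂, ?_, ?_⟩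
    · rw [rationalDomain_inter]; exact ⟨h₁, h₂⟩
    · rw [rationalDomain_inter]; exact Set.inter_subset_inter k₁ k₂
  | sUnion S hS ih =>
    obtain ⟨s, hs, hxs⟩ := hx
    obtain ⟨l, b, h, k⟩ := ih s hs (pre s (hS s hs)) hxs
    exact ⟨l, b, h, fun y hy => ⟨s, hs, k hy⟩⟩

/-- Analytic series restrict to smaller rational domains. -/
theorem AnalyticSeries.exists_restrict {l l' : List A} {b b' : A} (hb : b ∣ b')
    (hl : rationalTilde l' b' ⊆ rationalTilde l b) (g : AnalyticSeries l b) :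
    ∃ g' : AnalyticSeries l' b', ∀ (x : Place A) (hx : x ∈ rationalTilde l' b'),
      AnalyticSeries.eval l' b' ⟨x, hx⟩ g' = AnalyticSeries.eval l b ⟨x, hl hx⟩ g := by
  have hu : IsUnit (algebraMap A (Localization.Away b') b) :=
    isUnit_of_dvd_unit (map_dvd _ hb) (IsLocalization.Away.algebraMap_isUnit b')
  let r : PreSeries l b →+* PreSeries l' b' :=
    (IsLocalization.Away.lift b hu : Localization.Away b →+* Localization.Away b')
  have hr : ∀ (x : Place A) (hx : x ∈ rationalTilde l' b') (z : PreSeries l b),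
      PreSeries.toProd l' b' (r z) ⟨x, hx⟩ = PreSeries.toProd l b z ⟨x, hl hx⟩ := by
    intro x hx z
    have : (awayToValueRing x (rationalTilde.functorial hx) b' (hx.1.2 b' dvd_rfl)).comp
        (IsLocalization.Away.lift b hu : Localization.Away b →+* Localization.Away b') =
        awayToValueRing x (rationalTilde.functorial hx) b ((hl hx).1.2 b dvd_rfl) := by
      refine IsLocalization.ringHom_ext (Submonoid.powers b) (RingHom.ext fun a => ?_)
      simp [awayToValueRing, IsLocalization.Away.lift_eq]
    exact RingHom.congr_fun this z
  have hc : Continuous r := by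
    refine continuous_induced_rng.2 (continuous_pi fun x => ?_)
    have : (fun z => (PreSeries.toProd l' b' ∘ r) z x) =
        fun z => PreSeries.toProd l b z ⟨x.1, hl x.2⟩ := funext fun z => hr x.1 x.2 z
    rw [this]
    exact PreSeries.continuous_coord l b ⟨x.1, hl x.2⟩
  refine ⟨UniformSpace.Completion.mapRingHom r hc g, fun x hx => ?_⟩
  induction g using UniformSpace.Completion.induction_on with
  | hp =>
    exact isClosed_eq
      (UniformSpace.Completion.continuous_extension.comp UniformSpace.Completion.continuous_map)
      UniformSpace.Completion.continuous_extension
  | ih z =>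
    rw [UniformSpace.Completion.mapRingHom_coe]
    unfold AnalyticSeries.eval
    rw [UniformSpace.Completion.extensionHom_coe, UniformSpace.Completion.extensionHom_coe]
    exact hr x hx z

/-- Two analytic functions are given around a point by analytic series on the same domain. -/
theorem IsAnalyticOn.common {U : Set (SpehA A)} {f₁ f₂ : ∀ x : U, ResidueField x.1}
    (h₁ : IsAnalyticOn U f₁) (h₂ : IsAnalyticOn U f₂) (x₀ : SpehA A) (hx₀ : x₀ ∈ U) :
    ∃ (l : List A) (b : A) (hR : rationalDomain l b ⊆ U), x₀ ∈ rationalDomain l b ∧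
      ∃ g₁ g₂ : AnalyticSeries l b, ∀ (x : SpehA A) (hx : x ∈ rationalDomain l b),
        f₁ ⟨x, hR hx⟩ = AnalyticSeries.eval l b ⟨x.1, mem_rationalTilde hx⟩ g₁ ∧
        f₂ ⟨x, hR hx⟩ = AnalyticSeries.eval l b ⟨x.1, mem_rationalTilde hx⟩ g₂ := by
  obtain ⟨l₁, b₁, k₁, m₁, g₁, e₁⟩ := h₁ x₀ hx₀
  obtain ⟨l₂, b₂, k₂, m₂, g₂, e₂⟩ := h₂ x₀ hx₀
  obtain ⟨g₁', e₁'⟩ := AnalyticSeries.exists_restrict (dvd_mul_right b₁ b₂)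
    (rationalTilde_inter_left l₁ l₂ b₁ b₂) g₁
  obtain ⟨g₂', e₂'⟩ := AnalyticSeries.exists_restrict (dvd_mul_left b₂ b₁)
    (rationalTilde_inter_right l₁ l₂ b₁ b₂) g₂
  have hi := rationalDomain_inter l₁ l₂ b₁ b₂
  refine ⟨interList l₁ b₁ l₂ b₂, b₁ * b₂, fun x hx => k₁ (hi.subset hx).1,
    hi.superset ⟨m₁, m₂⟩, g₁', g₂', fun x hx => ⟨?_, ?_⟩⟩
  · rw [e₁', e₁ x (hi.subset hx).1]
  · rw [e₂', e₂ x (hi.subset hx).2]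

/-- The ring of analytic functions on an open subset of the analytic spectrum (with the topology
induced by the product of the topologies of the residue fields). -/
noncomputable def analyticFunctions (U : TopologicalSpace.Opens (SpehA A)) :
    Subring (∀ x : (U : Set (SpehA A)), ResidueField x.1) where
  carrier := {f | IsAnalyticOn (U : Set (SpehA A)) f}
  zero_mem' x hx := by
    obtain ⟨l, b, h, k⟩ := exists_rationalDomain_subset U.isOpen hx
    exact ⟨l, b, k, h, 0, fun y hy => (map_zero _).symm⟩
  one_mem' x hx := by
    obtain ⟨l, b, h, k⟩ := exists_rationalDomain_subset U.isOpen hx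
    exact ⟨l, b, k, h, 1, fun y hy => (map_one _).symm⟩
  add_mem' h₁ h₂ x hx := by
    obtain ⟨l, b, hR, h, g₁, g₂, e⟩ := IsAnalyticOn.common h₁ h₂ x hx
    refine ⟨l, b, hR, h, g₁ + g₂, fun y hy => ?_⟩
    rw [map_add, ← (e y hy).1, ← (e y hy).2, Pi.add_apply]
  mul_mem' h₁ h₂ x hx := by
    obtain ⟨l, b, hR, h, g₁, g₂, e⟩ := IsAnalyticOn.common h₁ h₂ x hx
    refine ⟨l, b, hR, h, g₁ * g₂, fun y hy => ?_⟩
    rw [map_mul, ← (e y hy).1, ← (e y hy).2, Pi.mul_apply]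
  neg_mem' h₁ x hx := by
    obtain ⟨l, b, hR, h, g₁, e⟩ := h₁ x hx
    refine ⟨l, b, hR, h, -g₁, fun y hy => ?_⟩
    rw [map_neg, ← e y hy, Pi.neg_apply]

/-- Restriction of analytic functions. -/
noncomputable def analyticFunctions.restrict {U V : TopologicalSpace.Opens (SpehA A)} (h : V ≤ U) :
    analyticFunctions U →+* analyticFunctions V where
  toFun f := ⟨fun x => f.1 ⟨x.1, h x.2⟩, fun x hx => by
    obtain ⟨l₁, b₁, k₁, m₁, g, e⟩ := f.2 x (h hx)
    obtain ⟨l₂, b₂, m₂, k₂⟩ := exists_rationalDomain_subset V.isOpen hx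
    obtain ⟨g', e'⟩ := AnalyticSeries.exists_restrict (dvd_mul_right b₁ b₂)
      (rationalTilde_inter_left l₁ l₂ b₁ b₂) g
    have hi := rationalDomain_inter l₁ l₂ b₁ b₂
    refine ⟨interList l₁ b₁ l₂ b₂, b₁ * b₂, fun y hy => k₂ (hi.subset hy).2,
      hi.superset ⟨m₁, m₂⟩, g', fun y hy => ?_⟩
    rw [e', ← e y (hi.subset hy).1]⟩
  map_one' := rfl
  map_zero' := rfl
  map_mul' _ _ := rfl
  map_add' _ _ := rfl

variable (A) in
/-- The presheaf of rings of analytic functions on the analytic spectrum. -/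
noncomputable def analyticPresheaf : TopCat.Presheaf CommRingCat.{u + 1} (TopCat.of (SpehA A)) where
  obj U := CommRingCat.of (analyticFunctions U.unop)
  map i := CommRingCat.ofHom (analyticFunctions.restrict i.unop.le)

/-- The ring of germs of analytic functions at a point of the analytic spectrum. -/
noncomputable abbrev AnalyticGerms (x : SpehA A) : Type (u + 1) :=
  (analyticPresheaf A).stalk x

/-- The open subset `{x | 0 < |m(x)|}` of the analytic spectrum. -/
def nonvanishing (m : A) : TopologicalSpace.Opens (SpehA A) where
  carrier := {x | 0 < x.1.norm m}
  is_open' := by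
    convert isOpen_rationalDomain ([] : List A) m using 1
    ext x
    refine Iff.trans ⟨fun h => ?_, fun h => ?_⟩ (SpehM.inRational_iff x.2.1).symm
    · exact ⟨by simp, (ne_of_lt h).symm⟩
    · exact lt_of_le_of_ne (IsPositiveAura.zero_le _) h.2.symm

end Analytic

/-! ### The standard seminorms on `ℤ` -/

/-- The residual seminorm `|.|_{q,0}` on `ℤ` for a prime ideal `(q)`: it is `0` on `(q)` and `1`
elsewhere. For `q = 0` it is the trivial norm `|.|_0`. -/
noncomputable def residualSeminorm (q : ℕ) (hq : q ≠ 1) : GSeminorm ℤ ℝ≥0 where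
  toFun n := if (q : ℤ) ∣ n then 0 else 1
  map_one := by
    rw [if_neg]
    intro h
    exact hq (by simpa using Int.natAbs_dvd_natAbs.2 h)
  map_zero := by simp
  map_mul_le a b := by
    by_cases ha : (q : ℤ) ∣ a
    · simp [ha, ha.mul_right b]
    by_cases hb : (q : ℤ) ∣ b
    · simp [hb, hb.mul_left a]
    simp only [ha, hb, if_false, mul_one]
    split_ifs <;> simp
  map_add_le a b := by
    by_cases ha : (q : ℤ) ∣ a
    · by_cases hb : (q : ℤ) ∣ b
      · simp [ha, hb, dvd_add ha hb]
      · simp only [ha, hb, if_false, if_true]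
        split_ifs <;> simp
    · simp only [ha, if_false]
      split_ifs <;> simp

/-- The trivial place `|.|_0` of `ℤ`. -/
noncomputable def trivialPlace : Place ℤ := (residualSeminorm 0 zero_ne_one).place

/-- The place `|.|_{p,0}` of `ℤ`. -/
noncomputable def residualPlace (p : ℕ) [hp : Fact p.Prime] : Place ℤ :=
  (residualSeminorm p hp.out.ne_one).place

/-- The `p`-adic norm on `ℤ`. -/
noncomputable def padicSeminorm (p : ℕ) [Fact p.Prime] : GSeminorm ℤ ℝ≥0 where
  toFun n := ‖(n : ℚ_[p])‖₊
  map_one := by simp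
  map_zero := by simp
  map_mul_le a b := by simp
  map_add_le a b := by
    rw [Int.cast_add]
    exact nnnorm_add_le _ _

/-- The place `|.|_p` of `ℤ`. -/
noncomputable def padicPlace (p : ℕ) [Fact p.Prime] : Place ℤ := (padicSeminorm p).place

/-- The usual archimedean norm on `ℤ`. -/
noncomputable def archSeminorm : GSeminorm ℤ ℝ≥0 where
  toFun n := (n.natAbs : ℝ≥0)
  map_one := by simp
  map_zero := by simp
  map_mul_le a b := by simp [Int.natAbs_mul]
  map_add_le a b := by exact_mod_cast Int.natAbs_add_le a b

/-- The place `|.|_∞` of `ℤ`. -/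
noncomputable def archPlace : Place ℤ := archSeminorm.place

/-! Every point of the spectrum is the norm of a complete normed field `F` pulled back to `ℤ`, where
`F` is `ℝ`, `ℚ_[p]`, or `ℚ` or `ZMod p` with the trivial norm. `IsModeledBy` records this up to
multiplicative equivalence. Since fractions of integers are dense in `F` and the radii they provide
are small enough, the multiplicative completion is `F` (`completionEquiv`). Functoriality of the
completion costs nothing: a ring morphism to `ℤ` is surjective, so pulling back along it does not
change the fractions.

That no other multiplicative tempered place exists is Ostrowski's theorem
(`IsMultiplicative.trichotomy`). Values lie in an abstract aura, so logarithms and real exponents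
are not available. Expansions in base `b` bound `|a|ᵏ` by a polynomial in `k`, and tempered growth
removes the polynomial. It is enough to recover the order on values: a multiplicative equivalence
class is determined by it.

Over `ℤ` the sets `R` and `R̃` have the same points, so analytic series on `R` amount to the closure
of `ℤ[1/b]` in the product of the residue fields (`AnalyticSeries.exists_eval_eq_iff`,
`isAnalyticOn_iff_closure`). Two computations of closures then decide everything. At `|.|_0` the
residue field is discrete and contains `ℤ[1/b]`, so taking the closure adds nothing. As every
rational domain around `|.|_0` contains all places of characteristic zero, an analytic function
there is a single rational number (`IsAnalyticOn.exists_rat`). At `|.|_{p,0}` every neighbourhood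
contains `|.|_p`, and the image of `ℤ[1/b]` in `ℚ_p × 𝔽_p` lies in the graph of the reduction `ℤ_p →
𝔽_p`, which is compact. So the value at `|.|_p` is a `p`-adic integer, and it determines the value
at `|.|_{p,0}` (`IsAnalyticOn.exists_padicInt`).

Hence a function on `{0 < |m|}` is a rational number integral at every prime not dividing `m`, that
is an element of `ℤ[1/m]`. Evaluation at `|.|_0` is a continuous injection to a discrete field, so
the topology is discrete. For germs, `|.|_∞` and `|.|_p` are open points, `|.|_{p,0}` has the
smallest neighbourhood `{|.|_{p,0}, |.|_p}`, and at `|.|_0` all non-zero integers become invertible.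
-/

/-! ### Auras -/

namespace IsPositiveAura

variable {R : Type*} [Semifield R] [LinearOrder R] [IsPositiveAura R]

theorem mul_le_mul_left_iff {x y z : R} (hz : z ≠ 0) : z * x ≤ z * y ↔ x ≤ y :=
  ⟨fun h => le_of_not_gt fun hlt => (IsPositiveAura.mul_lt_mul hz hlt).not_ge h,
    fun h => IsPositiveAura.mul_le_mul _ _ _ _ le_rfl h⟩

theorem div_mul_div_le_div_iff {a b c s t r : R} (hs : s ≠ 0) (ht : t ≠ 0) (hr : r ≠ 0) :
    a / s * (c / r) ≤ b / t ↔ a * c * t ≤ b * (s * r) := by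
  rw [← mul_le_mul_left_iff (mul_ne_zero (mul_ne_zero hs hr) ht)]
  have h1 : s * r * t * (a / s * (c / r)) = a * c * t := by field_simp
  have h2 : s * r * t * (b / t) = b * (s * r) := by field_simp
  rw [h1, h2]

theorem le_zero_iff {x : R} : x ≤ 0 ↔ x = 0 :=
  ⟨fun h => le_antisymm h (zero_le x), fun h => h.le⟩

theorem pos_iff_ne_zero {x : R} : 0 < x ↔ x ≠ 0 :=
  ⟨fun h => h.ne', fun h => lt_of_le_of_ne (zero_le x) h.symm⟩

end IsPositiveAura

/-! ### Seminorms modeled on a normed field -/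

namespace GSeminorm

section Modeled

variable {A : Type*} [CommRing A] {R : Type*} [Semifield R] [LinearOrder R]
variable {F : Type*} [NormedField F]

/-- The seminorm `a ↦ ‖φ a‖` defined by a ring morphism to a normed field. -/
def ofRingHom (φ : A →+* F) : GSeminorm A ℝ≥0 where
  toFun a := ‖φ a‖₊
  map_one := by simp
  map_zero := by simp
  map_mul_le a b := by simp
  map_add_le a b := by rw [map_add]; exact nnnorm_add_le _ _

/-- The seminorm `v` is multiplicatively equivalent to `a ↦ ‖φ a‖`. -/
def IsModeledBy (v : GSeminorm A R) (φ : A →+* F) : Prop :=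
  ∀ a b c, v a * v c ≤ v b ↔ ‖φ a‖ * ‖φ c‖ ≤ ‖φ b‖

theorem isModeledBy_iff {v : GSeminorm A R} {φ : A →+* F} :
    v.IsModeledBy φ ↔ v.MulEquivalent (ofRingHom φ) :=
  ⟨fun h a b c => (h a b c).symm, fun h a b c => (h a b c).symm⟩

theorem isModeledBy_ofRingHom (φ : A →+* F) : (ofRingHom φ).IsModeledBy φ :=
  fun _ _ _ => Iff.rfl

namespace IsModeledBy

variable {v : GSeminorm A R} {φ : A →+* F}

theorem isMultiplicative (h : v.IsModeledBy φ) : v.IsMultiplicative := fun a b =>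
  le_antisymm (v.map_mul_le a b) ((h a (a * b) b).2 (by simp))

theorem le_iff (h : v.IsModeledBy φ) {a b : A} : v a ≤ v b ↔ ‖φ a‖ ≤ ‖φ b‖ := by
  simpa [v.map_one] using h a b 1

theorem lt_iff (h : v.IsModeledBy φ) {a b : A} : v a < v b ↔ ‖φ a‖ < ‖φ b‖ :=
  lt_iff_lt_of_le_iff_le h.le_iff

theorem comap (h : v.IsModeledBy φ) {B : Type*} [CommRing B] (f : B →+* A) :
    (v.comap f).IsModeledBy (φ.comp f) := fun a b c => h (f a) (f b) (f c)

variable [IsPositiveAura R]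

theorem eq_zero_iff (h : v.IsModeledBy φ) {a : A} : v a = 0 ↔ φ a = 0 := by
  have := h.le_iff (a := a) (b := 0)
  rwa [v.map_zero, IsPositiveAura.le_zero_iff, φ.map_zero, norm_zero, norm_le_zero_iff] at this

theorem mem_mulElts (h : v.IsModeledBy φ) {a : A} : a ∈ v.mulElts ↔ φ a ≠ 0 := by
  rw [h.isMultiplicative.mem_mulElts, Ne, h.eq_zero_iff]

/-- The extension of `φ` to the localization at the multiplicative elements. -/
noncomputable def lift (h : v.IsModeledBy φ) : Localization v.mulElts →+* F :=
  IsLocalization.lift (M := v.mulElts) (g := φ) fun s =>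
    isUnit_iff_ne_zero.2 (h.mem_mulElts.1 s.2)

theorem lift_mk (h : v.IsModeledBy φ) (a : A) (s : v.mulElts) :
    h.lift (Localization.mk a s) = φ a / φ s := by
  have hs : φ s ≠ 0 := h.mem_mulElts.1 s.2
  rw [lift, Localization.mk_eq_mk', IsLocalization.lift_mk'_spec, mul_div_cancel₀ _ hs]

theorem lift_algebraMap (h : v.IsModeledBy φ) (a : A) :
    h.lift (algebraMap A _ a) = φ a := IsLocalization.lift_eq _ _

/-- Clearing denominators turns an inequality between fractions into one between elements of `A`,
since both sides are multiplicative. -/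
theorem localize (h : v.IsModeledBy φ) : v.localize.IsModeledBy h.lift := by
  intro p q r
  induction p with | H p => ?_
  induction q with | H q => ?_
  induction r with | H r => ?_
  obtain ⟨a, s⟩ := p
  obtain ⟨b, t⟩ := q
  obtain ⟨c, u⟩ := r
  have hm := h.isMultiplicative
  rw [localize_mk, localize_mk, localize_mk,
    IsPositiveAura.div_mul_div_le_div_iff s.2.1.ne_zero t.2.1.ne_zero u.2.1.ne_zero,
    ← hm, ← hm, ← hm, ← hm, h.le_iff, h.lift_mk, h.lift_mk, h.lift_mk, ← norm_mul,
    div_mul_div_comm, norm_div, norm_div,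
    div_le_div_iff₀ (norm_pos_iff.2 (mul_ne_zero (h.mem_mulElts.1 s.2) (h.mem_mulElts.1 u.2)))
      (norm_pos_iff.2 (h.mem_mulElts.1 t.2))]
  simp

end IsModeledBy

end Modeled

/-! ### Dense models -/

/-- The set of fractions `φ a / φ s` in `F`. -/
def fractions {A F : Type*} [CommRing A] [Field F] (φ : A →+* F) : Set F :=
  {t | ∃ a s, φ s ≠ 0 ∧ t = φ a / φ s}

/-- The fractions of the image of `φ` are dense, and the balls whose radii are the norms of
non-zero fractions are small. -/
structure IsDenseModel {A F : Type*} [CommRing A] [NormedField F] (φ : A →+* F) : Prop where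
  dense : Dense (fractions φ)
  small : ∀ ε > 0, ∃ r ∈ fractions φ, r ≠ 0 ∧ ∀ t ∈ fractions φ, ‖t‖ < ‖r‖ → ‖t‖ < ε

theorem fractions_comp {A B F : Type*} [CommRing A] [CommRing B] [Field F] (φ : A →+* F)
    {f : B →+* A} (hf : Function.Surjective f) : fractions (φ.comp f) = fractions φ := by
  ext t
  refine ⟨fun ⟨a, s, hs, ht⟩ => ⟨f a, f s, hs, ht⟩, fun ⟨a, s, hs, ht⟩ => ?_⟩
  obtain ⟨a, rfl⟩ := hf a
  obtain ⟨s, rfl⟩ := hf s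
  exact ⟨a, s, hs, ht⟩

theorem IsDenseModel.comp {A B F : Type*} [CommRing A] [CommRing B] [NormedField F] {φ : A →+* F}
    (h : IsDenseModel φ) {f : B →+* A} (hf : Function.Surjective f) :
    IsDenseModel (φ.comp f) := by
  constructor
  · rw [fractions_comp φ hf]; exact h.dense
  · rw [fractions_comp φ hf]; exact h.small

/-! ### Completion of a seminorm with a dense model -/

section

variable {A : Type*} [CommRing A] {R : Type*} [Semifield R] [LinearOrder R] [IsPositiveAura R]
variable {F : Type*} [NormedField F]
variable {v : GSeminorm A R} {φ : A →+* F}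

namespace IsModeledBy

theorem range_lift (h : v.IsModeledBy φ) : Set.range h.lift = fractions φ := by
  ext t
  constructor
  · rintro ⟨p, rfl⟩
    induction p with | H p => ?_
    exact ⟨p.1, p.2, h.mem_mulElts.1 p.2.2, h.lift_mk _ _⟩
  · rintro ⟨a, s, hs, rfl⟩
    exact ⟨Localization.mk a ⟨s, h.mem_mulElts.2 hs⟩, h.lift_mk _ _⟩

theorem mem_ball_localize (h : v.IsModeledBy φ) {a z : Localization v.mulElts} :
    z ∈ v.localize.ball 0 a ↔ ‖h.lift z‖ < ‖h.lift a‖ := by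
  change v.localize (z - 0) < _ ↔ _
  rw [sub_zero, h.localize.lt_iff]

theorem localize_pos (h : v.IsModeledBy φ) {a : Localization v.mulElts} :
    0 < v.localize a ↔ 0 < ‖h.lift a‖ := by
  rw [← v.localize.map_zero, h.localize.lt_iff, h.lift.map_zero, norm_zero]

theorem exists_radius (h : v.IsModeledBy φ) (hφ : IsDenseModel φ) {ε : ℝ} (hε : 0 < ε) :
    ∃ r : Localization v.mulElts, 0 < v.localize r ∧
      ∀ z ∈ v.localize.ball 0 r, ‖h.lift z‖ < ε := by
  obtain ⟨r, hr, hr0, hr1⟩ := hφ.small ε hε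
  rw [← h.range_lift] at hr hr1
  obtain ⟨r, rfl⟩ := hr
  refine ⟨r, h.localize_pos.2 (norm_pos_iff.2 hr0), fun z hz => ?_⟩
  exact hr1 _ ⟨z, rfl⟩ (h.mem_ball_localize.1 hz)

theorem hasMulTinyBalls (h : v.IsModeledBy φ) (hφ : IsDenseModel φ) : v.HasMulTinyBalls where
  add a ha := by
    have ha' := h.localize_pos.1 ha
    obtain ⟨r, hr, hr'⟩ := h.exists_radius hφ (half_pos ha')
    refine ⟨r, hr, fun y hy z hz => ?_⟩
    rw [h.mem_ball_localize, map_add]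
    linarith [norm_add_le (h.lift y) (h.lift z), hr' y hy, hr' z hz]
  mul_left a ha x := by
    have ha' := h.localize_pos.1 ha
    have hx : 0 < ‖h.lift x‖ + 1 := by positivity
    obtain ⟨r, hr, hr'⟩ := h.exists_radius hφ (div_pos ha' hx)
    refine ⟨r, hr, fun z hz => ?_⟩
    rw [h.mem_ball_localize, map_mul, norm_mul]
    have h1 := (lt_div_iff₀ hx).1 (hr' z hz)
    nlinarith [norm_nonneg (h.lift z)]
  mul a ha := by
    have ha' := h.localize_pos.1 ha
    -- One factor is bounded by `1`, the other by the radius to be reached.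
    obtain ⟨r, hr, hr'⟩ := h.exists_radius hφ (lt_min one_pos ha')
    refine ⟨r, hr, fun y hy z hz => ?_⟩
    rw [h.mem_ball_localize, map_mul, norm_mul]
    have h1 := (hr' y hy).trans_le (min_le_left _ _)
    have h2 := (hr' z hz).trans_le (min_le_right _ _)
    nlinarith [norm_nonneg (h.lift z), norm_nonneg (h.lift y)]
  neg a ha := by
    refine ⟨a, ha, fun z hz => ?_⟩
    rw [h.mem_ball_localize] at hz ⊢
    simpa using hz

variable (h : v.IsModeledBy φ) (hφ : IsDenseModel φ) (ht : v.HasMulTinyBalls)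

/-- The extension of `φ` to the localization with its ball topology. -/
noncomputable def ballLift : BallRing v.localize ht →+* F := h.lift

theorem isInducing_ballLift (hφ : IsDenseModel φ) : Topology.IsInducing (h.ballLift ht) := by
  -- Seminorm balls have only norms of non-zero fractions as radii. Each is the trace of a metric
  -- ball; conversely `exists_radius` puts one inside the trace of any metric ball. The other points
  -- follow by translation.
  have key : 𝓝 (0 : BallRing v.localize ht) = Filter.comap (h.ballLift ht) (𝓝 0) := by
    have hb := ht.ringFilterBasis.toAddGroupFilterBasis.nhds_zero_hasBasis
    have hc := (Metric.nhds_basis_ball (x := (0 : F))).comap (h.ballLift ht)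
    refine hb.ext hc ?_ ?_
    · rintro _ ⟨a, ha, rfl⟩
      refine ⟨‖h.lift a‖, h.localize_pos.1 ha, fun z hz => ?_⟩
      exact h.mem_ball_localize.2 (mem_ball_zero_iff.1 hz)
    · intro ε hε
      obtain ⟨r, hr, hr'⟩ := h.exists_radius hφ hε
      exact ⟨_, ⟨r, hr, rfl⟩, fun z hz => mem_ball_zero_iff.2 (hr' z hz)⟩
  refine Topology.isInducing_iff_nhds.2 fun x => ?_
  have h1 := map_add_left_nhds_zero x
  rw [← h1, key, ← map_add_left_nhds_zero (h.ballLift ht x)]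
  ext s
  simp only [Filter.mem_map, Filter.mem_comap]
  constructor
  · rintro ⟨t, ht', hts⟩
    refine ⟨(fun y => -(h.ballLift ht x) + y) ⁻¹' t,
      by simpa [Set.preimage_preimage] using ht', fun z hz => ?_⟩
    have := @hts (-x + z) (by simpa using hz)
    simpa using this
  · rintro ⟨t, ht', hts⟩
    refine ⟨_, ht', fun z hz => hts ?_⟩
    simpa using hz

theorem isUniformInducing_ballLift (hφ : IsDenseModel φ) :
    IsUniformInducing (h.ballLift ht) :=
  AddMonoidHom.isUniformInducing_of_isInducing (h.isInducing_ballLift ht hφ)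

variable [CompleteSpace F]

/-- The ring isomorphism between the separated completion and the model. -/
noncomputable def completionEquiv : v.localize.SepCompletion ht ≃+* F :=
  RingEquiv.ofBijective (UniformSpace.Completion.extensionHom (h.ballLift ht)
    (h.isInducing_ballLift ht hφ).continuous) <| by
  have hu : IsUniformInducing (UniformSpace.Completion.extensionHom (h.ballLift ht)
      (h.isInducing_ballLift ht hφ).continuous) :=
    UniformSpace.Completion.isUniformInducing_extension (h.isUniformInducing_ballLift ht hφ)
  refine ⟨hu.injective, fun t => ?_⟩
  have hc : IsClosed (Set.range (UniformSpace.Completion.extensionHom (h.ballLift ht)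
      (h.isInducing_ballLift ht hφ).continuous)) := hu.isComplete_range.isClosed
  refine hc.closure_subset_iff.2 ?_ (hφ.dense t)
  rw [← h.range_lift]
  rintro _ ⟨z, rfl⟩
  exact ⟨((show BallRing v.localize ht from z : BallRing v.localize ht) :
    v.localize.SepCompletion ht), UniformSpace.Completion.extensionHom_coe _ _ _⟩

theorem completionEquiv_toSepCompletion (z : Localization v.mulElts) :
    h.completionEquiv hφ ht (v.localize.toSepCompletion ht z) = h.lift z :=
  UniformSpace.Completion.extensionHom_coe _ (h.isInducing_ballLift ht hφ).continuous _

theorem isHomeomorph_completionEquiv : IsHomeomorph (h.completionEquiv hφ ht) := by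
  have hu : IsUniformInducing (h.completionEquiv hφ ht) :=
    UniformSpace.Completion.isUniformInducing_extension (h.isUniformInducing_ballLift ht hφ)
  exact isHomeomorph_iff_isEmbedding_surjective.2
    ⟨⟨hu.isInducing, (h.completionEquiv hφ ht).injective⟩, (h.completionEquiv hφ ht).surjective⟩

end IsModeledBy

end

/-! ### Functorial completions from dense models -/

section Functorial

variable {A : Type} [CommRing A] {R : Type} [Semifield R] [LinearOrder R] [IsPositiveAura R]
variable {F : Type*} [NormedField F] [CompleteSpace F]
variable {v : GSeminorm A R} {φ : A →+* F}

/-- The continuous extension is the norm of `F` transported through `completionEquiv`; it takes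
values in `ℝ≥0` whatever the aura of `v` is. -/
theorem IsModeledBy.extendsToCompletion (h : v.IsModeledBy φ) (hφ : IsDenseModel φ)
    (ht : v.HasMulTinyBalls) : v.localize.ExtendsToCompletion ht := by
  let e := (h.completionEquiv hφ ht).toRingHom
  have he : Continuous e := (h.isHomeomorph_completionEquiv hφ ht).continuous
  refine ⟨ℝ≥0, inferInstance, inferInstance, inferInstance, ofRingHom e, ?_, fun z hz => ?_⟩
  · have h1 := isModeledBy_iff.1 h.localize
    have h2 : (ofRingHom e).comap (v.localize.toSepCompletion ht) = ofRingHom h.lift := by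
      unfold ofRingHom GSeminorm.comap
      congr 1
      funext z
      exact congrArg (fun t : F => ‖t‖₊) (h.completionEquiv_toSepCompletion hφ ht z)
    rw [h2]
    exact h1
  · have h1 : IsOpen ((ofRingHom e).ball 0 z) := by
      have : (ofRingHom e).ball 0 z = (fun y => ‖e y‖₊) ⁻¹' Set.Iio (ofRingHom e z) := by
        ext y
        change ofRingHom e (y - 0) < _ ↔ _
        rw [sub_zero]
        rfl
      rw [this]
      exact isOpen_Iio.preimage (continuous_nnnorm.comp he)
    refine h1.mem_nhds ?_
    change ofRingHom e (0 - 0) < _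
    rwa [sub_zero, (ofRingHom e).map_zero]

/-- A seminorm modeled on a complete normed field has a functorial multiplicative completion if
all ring morphisms to the ring are surjective. -/
theorem IsModeledBy.hasFunctorialMulCompletion (h : v.IsModeledBy φ) (hφ : IsDenseModel φ)
    (hA : ∀ (B : Type) [CommRing B] (f : B →+* A), Function.Surjective f) :
    v.HasFunctorialMulCompletion := by
  intro B _ f
  have hf := hA B f
  have hB := h.comap f
  have hφB := hφ.comp hf
  have h₁ : (v.comap f).mulElts ≤ v.mulElts.comap f := fun b hb => by
    rw [Submonoid.mem_comap, h.mem_mulElts]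
    exact hB.mem_mulElts.1 hb
  refine ⟨h₁, hB.hasMulTinyBalls hφB, hB.extendsToCompletion hφB _, fun a ha => ?_⟩
  have hmap : ∀ z, h.lift (IsLocalization.map (Localization v.mulElts) f h₁ z) = hB.lift z := by
    intro z
    have : h.lift.comp (IsLocalization.map (Localization v.mulElts) f h₁) = hB.lift := by
      refine IsLocalization.ringHom_ext (v.comap f).mulElts (RingHom.ext fun b => ?_)
      simp [h.lift_algebraMap, hB.lift_algebraMap]
    exact RingHom.congr_fun this z
  -- Surjectivity of `f` makes the value of `a` a fraction from `B`, so a ball of exactly the same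
  -- radius exists upstairs.
  have ha' : h.lift a ∈ Set.range hB.lift := by
    rw [hB.range_lift, fractions_comp φ hf, ← h.range_lift]
    exact ⟨a, rfl⟩
  obtain ⟨b, hb⟩ := ha'
  refine ⟨b, ?_, fun z hz => ?_⟩
  · rw [hB.localize_pos, hb]
    exact h.localize_pos.1 ha
  · rw [Set.mem_preimage, h.mem_ball_localize, hmap, ← hb]
    exact hB.mem_ball_localize.1 hz

end Functorial

end GSeminorm

/-! ### Ostrowski's theorem for auras of tempered growth -/

section AuraInstances

variable {R : Type*} [Semifield R] [LinearOrder R] [IsPositiveAura R]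

/-- This instance and the next open the library of ordered semirings to auras. Strict monotonicity
of multiplication is not an axiom: it comes from cancellation in a semifield. -/
instance IsPositiveAura.isOrderedRing : IsOrderedRing R where
  add_le_add_left _ _ h _ := IsPositiveAura.add_le_add _ _ _ _ h le_rfl
  zero_le_one := IsPositiveAura.zero_lt_one.le
  mul_le_mul_of_nonneg_left _ _ _ _ h := IsPositiveAura.mul_le_mul _ _ _ _ le_rfl h
  mul_le_mul_of_nonneg_right _ _ _ _ h := IsPositiveAura.mul_le_mul _ _ _ _ h le_rfl

instance IsPositiveAura.posMulStrictMono : PosMulStrictMono R where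
  mul_lt_mul_of_pos_left _ ha _ _ h := IsPositiveAura.mul_lt_mul ha.ne' h

end AuraInstances

namespace GSeminorm

section General

variable {A : Type*} [CommRing A] {R : Type*} [Semifield R] [LinearOrder R]
variable {v : GSeminorm A R}

theorem map_natCast_le [IsPositiveAura R] (n : ℕ) : v (n : A) ≤ (n : R) := by
  induction n with
  | zero => simp [v.map_zero]
  | succ n ih =>
    push_cast
    exact (v.map_add_le _ _).trans (add_le_add ih v.map_one.le)

namespace IsMultiplicative

theorem map_pow (hv : v.IsMultiplicative) (a : A) (n : ℕ) : v (a ^ n) = v a ^ n := by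
  induction n with
  | zero => simp [v.map_one]
  | succ n ih => rw [pow_succ, hv, ih, pow_succ]

theorem map_neg [IsPositiveAura R] (hv : v.IsMultiplicative) (a : A) : v (-a) = v a := by
  have h : v (-1) = 1 := by
    have h1 : v (-1) ^ 2 = 1 := by rw [← hv.map_pow]; simp [v.map_one]
    exact (pow_eq_one_iff_of_nonneg (IsPositiveAura.zero_le _) two_ne_zero).1 h1
  rw [neg_eq_neg_one_mul, hv, h, one_mul]

end IsMultiplicative

end General

section Int

variable {R : Type*} [Semifield R] [LinearOrder R] [IsPositiveAura R] {v : GSeminorm ℤ R}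

namespace IsMultiplicative

theorem map_natAbs (hv : v.IsMultiplicative) (a : ℤ) : v (a.natAbs : ℤ) = v a := by
  rcases Int.natAbs_eq a with h | h
  · rw [← h]
  · rw [← hv.map_neg, ← h]

/-- Expansion in base `b`: `N` has at most `k` digits, each of norm at most `b`, multiplied by
powers of `b` of norm at most `M ^ k`. The induction splits off the last digit. It is used with `M =
1` and with `M = |b|`. -/
theorem le_of_lt_pow (hv : v.IsMultiplicative) {b : ℕ} (hb : 0 < b) {M : R} (h1 : 1 ≤ M)
    (hM : v (b : ℤ) ≤ M) (k N : ℕ) (hN : N < b ^ k) :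
    v (N : ℤ) ≤ ((k * b : ℕ) : R) * M ^ k := by
  induction k generalizing N with
  | zero =>
    obtain rfl : N = 0 := by simpa using hN
    simp [v.map_zero]
  | succ k ih =>
    have hq : N / b < b ^ k := by
      rw [Nat.div_lt_iff_lt_mul hb, ← pow_succ]
      exact hN
    have e : (N : ℤ) = (b : ℤ) * ((N / b : ℕ) : ℤ) + ((N % b : ℕ) : ℤ) := by
      exact_mod_cast (Nat.div_add_mod N b).symm
    have h2 : v ((N % b : ℕ) : ℤ) ≤ (b : R) * M ^ (k + 1) := by
      have h3 : v ((N % b : ℕ) : ℤ) ≤ (b : R) :=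
        (v.map_natCast_le _).trans (Nat.mono_cast (Nat.mod_lt N hb).le)
      exact h3.trans (le_mul_of_one_le_right (IsPositiveAura.zero_le _) (one_le_pow₀ h1))
    calc v (N : ℤ) ≤ v (b : ℤ) * v ((N / b : ℕ) : ℤ) + v ((N % b : ℕ) : ℤ) := by
          conv_lhs => rw [e]
          rw [← hv]
          exact v.map_add_le _ _
      _ ≤ M * (((k * b : ℕ) : R) * M ^ k) + (b : R) * M ^ (k + 1) :=
          add_le_add (IsPositiveAura.mul_le_mul _ _ _ _ hM (ih _ hq)) h2
      _ = _ := by push_cast; ring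

theorem le_one_of_le_one (hv : v.IsMultiplicative) (ht : HasTemperedGrowth R)
    {b : ℕ} (hb : 2 ≤ b) (h : v (b : ℤ) ≤ 1)
    (a : ℕ) : v (a : ℤ) ≤ 1 := by
  obtain ⟨s, hs⟩ : ∃ s, a < b ^ s := ⟨a, Nat.lt_pow_self hb⟩
  -- The polynomial is `(s k + 1) b`: the number `a ^ k < b ^ (s k)` has fewer than `s k + 1` digits
  -- or exactly as many, and each contributes at most `b`.
  refine ht (Polynomial.C (s * b) * Polynomial.X + Polynomial.C b) ?_ _ fun k => ?_
  · intro h0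
    have := congrArg (Polynomial.eval 0) h0
    simp at this
    omega
  · rw [← hv.map_pow]
    have hN : a ^ k < b ^ (s * k + 1) := by
      rw [pow_succ, pow_mul]
      exact (Nat.pow_le_pow_left hs.le k).trans_lt
        (lt_mul_of_one_lt_right (by positivity) (by omega))
    have := hv.le_of_lt_pow (by omega) le_rfl h _ _ hN
    rw [one_pow, mul_one] at this
    convert this using 2
    · push_cast; rfl
    · simp; ring

/-- Since `a ^ k < b ^ (k + 1)`, the power `(|a| / |b|) ^ k` is at most `(k + 1) b |b|`, and
tempered growth applies to the quotient. -/
theorem monotone_of_one_lt (hv : v.IsMultiplicative) (ht : HasTemperedGrowth R)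
    {a b : ℕ} (hab : a < b)
    (h : 1 < v (b : ℤ)) : v (a : ℤ) ≤ v (b : ℤ) := by
  have hb0 : v (b : ℤ) ≠ 0 := (IsPositiveAura.zero_lt_one.trans h).ne'
  have hb : 0 < b := by omega
  have key : v (a : ℤ) / v (b : ℤ) ≤ 1 := by
    refine ht (Polynomial.C (b * b) * Polynomial.X + Polynomial.C (b * b)) ?_ _ fun k => ?_
    · intro h0
      have := congrArg (Polynomial.eval 0) h0
      simp at this
      omega
    · have hN : a ^ k < b ^ (k + 1) :=
        (Nat.pow_le_pow_left hab.le k).trans_lt (Nat.pow_lt_pow_right (by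
          rcases Nat.lt_or_ge 1 b with h' | h'
          · exact h'
          · obtain rfl : b = 1 := by omega
            simp [v.map_one] at h) (by omega))
      have h1 := hv.le_of_lt_pow hb h.le le_rfl _ _ hN
      rw [div_pow, ← IsPositiveAura.mul_le_mul_left_iff (pow_ne_zero k hb0),
        mul_div_cancel₀ _ (pow_ne_zero k hb0), ← hv.map_pow]
      push_cast at h1
      refine h1.trans ?_
      rw [pow_succ]
      -- Tempered growth admits only polynomials over `ℕ`, so the leftover factor `|b|` is replaced
      -- by the integer `b`; hence the coefficient `b * b`.
      have h2 : v (b : ℤ) ≤ (b : R) := v.map_natCast_le b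
      calc ((k : R) + 1) * b * (v (b : ℤ) ^ k * v (b : ℤ))
          = v (b : ℤ) ^ k * (((k : R) + 1) * b * v (b : ℤ)) := by
            rw [← mul_assoc, mul_comm _ (v (b : ℤ) ^ k), mul_assoc]
        _ ≤ v (b : ℤ) ^ k * (((k : R) + 1) * b * b) :=
            IsPositiveAura.mul_le_mul _ _ _ _ le_rfl
              (IsPositiveAura.mul_le_mul _ _ _ _ le_rfl h2)
        _ = _ := by
            congr 1
            simp
            ring
  rwa [← IsPositiveAura.mul_le_mul_left_iff hb0, mul_div_cancel₀ _ hb0, mul_one] at key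

/-- All integers `b ≥ 2` have norm greater than `1`, which gives monotonicity. If strictness failed,
taking powers would amplify the gap between `a` and `b` to a factor `2` and force `|2| ≤ 1`. -/
theorem strictMono_of_one_lt (hv : v.IsMultiplicative) (ht : HasTemperedGrowth R)
    {n : ℕ} (hn : 1 < v (n : ℤ)) :
    StrictMono fun a : ℕ => v (a : ℤ) := by
  have h2 : ∀ b : ℕ, 2 ≤ b → 1 < v (b : ℤ) := fun b hb => by
    by_contra h
    exact (hv.le_one_of_le_one ht hb (not_lt.1 h) n).not_gt hn
  have hmono : ∀ a b : ℕ, a ≤ b → v (a : ℤ) ≤ v (b : ℤ) := by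
    intro a b hab
    rcases hab.eq_or_lt with rfl | hab
    · exact le_rfl
    rcases Nat.lt_or_ge 1 b with hb | hb
    · exact hv.monotone_of_one_lt ht hab (h2 b hb)
    · obtain rfl : a = 0 := by omega
      simpa [v.map_zero] using IsPositiveAura.zero_le _
  intro a b hab
  have ha0 : a ≠ 0 → v (a : ℤ) ≠ 0 := fun ha => by
    have := hmono 1 a (by omega)
    simp only [Nat.cast_one, v.map_one] at this
    exact (IsPositiveAura.zero_lt_one.trans_le this).ne'
  by_contra hle
  have hle : v (b : ℤ) ≤ v (a : ℤ) := not_lt.1 hle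
  rcases Nat.eq_zero_or_pos a with rfl | ha
  · have := hmono 1 b hab
    simp only [Nat.cast_one, v.map_one, Nat.cast_zero, v.map_zero] at this hle
    exact (this.trans hle).not_gt IsPositiveAura.zero_lt_one
  -- Bernoulli's inequality `(1 + 1/a) ^ a ≥ 2` explains the exponent `a`; `h5` is its form without
  -- denominators.
  · have h3 : 2 * a ^ a ≤ b ^ a := by
      have h4 : (a + 1) ^ a ≤ b ^ a := Nat.pow_le_pow_left hab a
      have h5 : ∀ n, a ^ n * (a + n) ≤ (a + 1) ^ n * a := fun n => by
        induction n with
        | zero => simp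
        | succ n ih =>
          have := Nat.mul_le_mul_right (a + 1) ih
          have h6 := Nat.zero_le (a ^ n * n)
          rw [pow_succ, pow_succ]
          linarith
      refine le_trans (le_of_mul_le_mul_right ?_ ha) h4
      linarith [h5 a]
    have h4 := hmono _ _ h3
    push_cast at h4
    rw [hv, hv.map_pow, hv.map_pow] at h4
    have h5 : v 2 * v (a : ℤ) ^ a ≤ v (a : ℤ) ^ a :=
      h4.trans (pow_le_pow_left₀ (IsPositiveAura.zero_le _) hle a)
    rw [mul_comm] at h5
    have h6 := (IsPositiveAura.mul_le_mul_left_iff (pow_ne_zero a (ha0 ha.ne'))).1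
      (h5.trans (mul_one _).ge)
    exact h6.not_gt (by simpa using h2 2 le_rfl)

/-- No ultrametric inequality is known here. If both norms were at most `m < 1`, a Bézout relation
between `a ^ n` and `b ^ n` would give `1 ≤ 2 m ^ n` for all `n`, and tempered growth with the
constant polynomial `2` would give `m⁻¹ ≤ 1`. -/
theorem eq_one_or_eq_one_of_isCoprime (hv : v.IsMultiplicative) (ht : HasTemperedGrowth R)
    (h1 : ∀ n : ℕ, v (n : ℤ) ≤ 1)
    {a b : ℤ} (hab : IsCoprime a b) : v a = 1 ∨ v b = 1 := by
  have h1' : ∀ n : ℤ, v n ≤ 1 := fun n => hv.map_natAbs n ▸ h1 _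
  by_contra! hne
  set m := max (v a) (v b) with hm
  have hm1 : m < 1 := max_lt (lt_of_le_of_ne (h1' a) hne.1) (lt_of_le_of_ne (h1' b) hne.2)
  have key : ∀ n : ℕ, 1 ≤ 2 * m ^ n := fun n => by
    obtain ⟨x, y, hxy⟩ := hab.pow (m := n) (n := n)
    have h2 : ∀ x c : ℤ, v c ≤ m → v (x * c ^ n) ≤ m ^ n := fun x c hc => by
      rw [hv, hv.map_pow]
      calc _ ≤ 1 * m ^ n := IsPositiveAura.mul_le_mul _ _ _ _ (h1' x)
            (pow_le_pow_left₀ (IsPositiveAura.zero_le _) hc n)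
        _ = _ := one_mul _
    rw [two_mul, ← v.map_one, ← hxy]
    exact (v.map_add_le _ _).trans (add_le_add (h2 _ _ (le_max_left _ _)) (h2 _ _ (le_max_right _ _)))
  have hm0 : m ≠ 0 := by
    intro h0
    have := key 1
    rw [h0] at this
    simp at this
    exact this.not_gt IsPositiveAura.zero_lt_one
  have := ht (Polynomial.C 2) (by simp) m⁻¹ fun n => by
    rw [← IsPositiveAura.mul_le_mul_left_iff (pow_ne_zero n hm0), inv_pow,
      mul_inv_cancel₀ (pow_ne_zero n hm0), mul_comm]
    simpa using key n
  rw [← IsPositiveAura.mul_le_mul_left_iff hm0, mul_inv_cancel₀ hm0, mul_one] at this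
  exact this.not_gt hm1

end IsMultiplicative

/-- The classification of the multiplicative seminorms on `ℤ` of tempered growth by the size of
the integers. -/
theorem IsMultiplicative.trichotomy (hv : v.IsMultiplicative) (ht : HasTemperedGrowth R) :
    (StrictMono fun a : ℕ => v (a : ℤ)) ∨ (∀ n : ℤ, n ≠ 0 → v n = 1) ∨
      ∃ p : ℕ, p.Prime ∧ v (p : ℤ) < 1 ∧ ∀ n : ℤ, ¬(p : ℤ) ∣ n → v n = 1 := by
  by_cases h : ∃ n : ℕ, 1 < v (n : ℤ)
  · obtain ⟨n, hn⟩ := h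
    exact Or.inl (hv.strictMono_of_one_lt ht hn)
  push Not at h
  refine Or.inr (or_iff_not_imp_right.2 fun hp => ?_)
  have hp1 : ∀ p : ℕ, p.Prime → v (p : ℤ) = 1 := fun p pp => by
    by_contra h1
    refine hp ⟨p, pp, lt_of_le_of_ne (h p) h1, fun n hn => ?_⟩
    have hc : IsCoprime (p : ℤ) n :=
      ((Nat.prime_iff_prime_int.1 pp).irreducible.coprime_iff_not_dvd).2 hn
    exact (hv.eq_one_or_eq_one_of_isCoprime ht h hc).resolve_left h1
  have h1 : ∀ n : ℕ, n ≠ 0 → v (n : ℤ) = 1 := fun n => by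
    induction n using Nat.recOnMul with
    | zero => simp
    | one => simp [v.map_one]
    | prime p pp => exact fun _ => hp1 p pp
    | mul a b ha hb =>
      intro hab
      rw [Nat.cast_mul, hv, ha (left_ne_zero_of_mul hab), hb (right_ne_zero_of_mul hab), one_mul]
  intro n hn
  rw [← hv.map_natAbs]
  exact h1 _ (Int.natAbs_ne_zero.2 hn)

end Int

end GSeminorm

/-! ### The trivially normed fields -/

/-- The field `K` with its trivial norm. -/
abbrev TrivNorm (K : Type*) [Field K] : Type _ :=
  letI : DecidablePred fun x : K => x = 0 := Classical.decPred _
  WithAbs (AbsoluteValue.trivial : AbsoluteValue K ℝ)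

namespace TrivNorm

variable {K : Type*} [Field K]

theorem norm_of_ne_zero {x : TrivNorm K} (hx : x ≠ 0) : ‖x‖ = 1 := by
  rw [WithAbs.norm_eq_apply_ofAbs]
  exact if_neg (by simpa using hx)

theorem eq_zero_of_norm_lt_one {x : TrivNorm K} (hx : ‖x‖ < 1) : x = 0 := by
  by_contra h
  exact hx.ne (norm_of_ne_zero h)

/-- Distinct points are at distance `1`. This supplies both completeness and the discrete topology
of the trivially normed models. -/
instance discreteUniformity : DiscreteUniformity (TrivNorm K) := by
  refine ⟨Metric.uniformSpace_eq_bot.2 ⟨1, one_pos, fun x y hxy => ?_⟩⟩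
  beta_reduce
  rw [dist_eq_norm, norm_of_ne_zero (sub_ne_zero.2 hxy)]

end TrivNorm

/-! ### Places of `ℤ` -/

namespace GSeminorm

/-- For the trivial norm the open ball of radius `‖1‖` is already `{0}`. -/
theorem isDenseModel_of_trivNorm {A K : Type*} [CommRing A] [Field K] (φ : A →+* TrivNorm K)
    (h : fractions φ = Set.univ) : IsDenseModel φ where
  dense := by rw [h]; exact dense_univ
  small ε hε := by
    rw [h]
    refine ⟨1, trivial, one_ne_zero, fun t _ ht => ?_⟩
    rw [norm_one] at ht
    rwa [TrivNorm.eq_zero_of_norm_lt_one ht, norm_zero]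

/-- The powers of `c` are fractions of arbitrarily small non-zero norm. -/
theorem isDenseModel_of_norm_lt_one {A F : Type*} [CommRing A] [NormedField F] (φ : A →+* F)
    (h : Dense (fractions φ)) {c : F} (hc : c ∈ fractions φ) (hc0 : c ≠ 0) (hc1 : ‖c‖ < 1) :
    IsDenseModel φ where
  dense := h
  small ε hε := by
    obtain ⟨n, hn⟩ := exists_pow_lt_of_lt_one hε hc1
    obtain ⟨a, s, hs, rfl⟩ := hc
    refine ⟨_, ⟨a ^ n, s ^ n, by simpa using pow_ne_zero n hs, rfl⟩, ?_, fun t _ ht => ?_⟩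
    · rw [map_pow, map_pow, ← div_pow]
      exact pow_ne_zero n hc0
    · refine ht.trans ?_
      rwa [map_pow, map_pow, ← div_pow, norm_pow]

theorem ratCast_mem_fractions {F : Type*} [Field F] [CharZero F] (q : ℚ) :
    (q : F) ∈ fractions (Int.castRingHom F) :=
  ⟨q.num, q.den, by simp, by simp [Rat.cast_def]⟩

theorem isDenseModel_rat : IsDenseModel (Int.castRingHom (TrivNorm ℚ)) := by
  refine isDenseModel_of_trivNorm _ (Set.eq_univ_of_forall fun t => ?_)
  refine ⟨t.ofAbs.num, t.ofAbs.den, ?_, ?_⟩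
  · intro h
    have := congrArg (WithAbs.equiv _) h
    simp at this
  · apply (WithAbs.equiv _).injective
    rw [map_div₀]
    simp [Rat.num_div_den]

theorem isDenseModel_zmod (p : ℕ) [Fact p.Prime] :
    IsDenseModel (Int.castRingHom (TrivNorm (ZMod p))) := by
  refine isDenseModel_of_trivNorm _ (Set.eq_univ_of_forall fun t => ?_)
  obtain ⟨n, hn⟩ := ZMod.intCast_surjective t.ofAbs
  refine ⟨n, 1, by simp, ?_⟩
  apply (WithAbs.equiv _).injective
  simp [hn]

theorem isDenseModel_real : IsDenseModel (Int.castRingHom ℝ) := by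
  refine isDenseModel_of_norm_lt_one _ ?_ (ratCast_mem_fractions (1 / 2)) (by simp) (by norm_num)
  refine Rat.denseRange_cast.mono ?_
  rintro _ ⟨q, rfl⟩
  exact ratCast_mem_fractions q

theorem isDenseModel_padic (p : ℕ) [hp : Fact p.Prime] : IsDenseModel (Int.castRingHom ℚ_[p]) := by
  refine isDenseModel_of_norm_lt_one _ ?_ (ratCast_mem_fractions (p : ℚ)) ?_ ?_
  · refine (Padic.denseRange_ratCast p).mono ?_
    rintro _ ⟨q, rfl⟩
    exact ratCast_mem_fractions q
  · simpa using hp.out.ne_zero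
  · simpa using Padic.norm_p_lt_one (p := p)

end GSeminorm

open GSeminorm

theorem residualSeminorm_zero_eq :
    residualSeminorm 0 zero_ne_one = ofRingHom (Int.castRingHom (TrivNorm ℚ)) := by
  unfold residualSeminorm ofRingHom
  congr 1
  funext n
  rcases eq_or_ne n 0 with rfl | hn
  · simp
  · have : (n : TrivNorm ℚ) ≠ 0 := fun h => hn (by
      have := congrArg (WithAbs.equiv _) h
      simpa using this)
    rw [if_neg (by simpa using hn)]
    exact (NNReal.eq (by simpa using TrivNorm.norm_of_ne_zero this) : ‖(n : TrivNorm ℚ)‖₊ = 1).symm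

theorem residualSeminorm_prime_eq (p : ℕ) [hp : Fact p.Prime] :
    residualSeminorm p hp.out.ne_one = ofRingHom (Int.castRingHom (TrivNorm (ZMod p))) := by
  unfold residualSeminorm ofRingHom
  congr 1
  funext n
  have key : (n : TrivNorm (ZMod p)) = 0 ↔ (p : ℤ) ∣ n := by
    rw [← ZMod.intCast_zmod_eq_zero_iff_dvd, ← (WithAbs.equiv _).injective.eq_iff]
    simp
  split_ifs with h
  · simp [key.2 h]
  · exact (NNReal.eq (by simpa using TrivNorm.norm_of_ne_zero (mt key.1 h)) :
      ‖(n : TrivNorm (ZMod p))‖₊ = 1).symm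

theorem archSeminorm_eq : archSeminorm = ofRingHom (Int.castRingHom ℝ) := by
  unfold archSeminorm ofRingHom
  congr 1
  funext n
  apply NNReal.eq
  simp [Nat.cast_natAbs]

namespace Place

/-- The place of `ℤ` defined by the norm of `F`. -/
noncomputable def ofField (F : Type*) [NormedField F] : Place ℤ :=
  (ofRingHom (Int.castRingHom F)).place

theorem trivialPlace_eq : trivialPlace = ofField (TrivNorm ℚ) := by
  rw [trivialPlace, residualSeminorm_zero_eq, ofField]

theorem residualPlace_eq (p : ℕ) [Fact p.Prime] :
    residualPlace p = ofField (TrivNorm (ZMod p)) := by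
  rw [residualPlace, residualSeminorm_prime_eq, ofField]

theorem padicPlace_eq (p : ℕ) [Fact p.Prime] : padicPlace p = ofField ℚ_[p] := rfl

theorem archPlace_eq : archPlace = ofField ℝ := by
  rw [archPlace, archSeminorm_eq, ofField]

theorem place_eq_iff.{w} {A R : Type w} [CommRing A] [Semifield R] [LinearOrder R]
    [IsPositiveAura R] {v : GSeminorm A R} {x : Place A} :
    v.place = x ↔ v.MulEquivalent x.norm :=
  ⟨fun h => Quotient.exact (h.trans x.place_norm.symm),
    fun h => (Quotient.sound h : v.place = x.norm.place).trans x.place_norm⟩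

/-- Translates an equality of places into a property of the chosen representative `x.norm`, whose
aura of values is otherwise unknown. -/
theorem eq_ofField_iff {F : Type*} [NormedField F] {x : Place ℤ} :
    x = ofField F ↔ x.norm.IsModeledBy (Int.castRingHom F) := by
  rw [eq_comm, ofField, place_eq_iff, isModeledBy_iff]
  exact ⟨fun h a b c => (h a b c).symm, fun h a b c => (h a b c).symm⟩

theorem isModeledBy_ofField (F : Type*) [NormedField F] :
    (ofField F).norm.IsModeledBy (Int.castRingHom F) := eq_ofField_iff.1 rfl

end Place

theorem NNReal.hasTemperedGrowth : HasTemperedGrowth ℝ≥0 := by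
  intro P hP x h
  by_contra! hx
  have hx' : 1 < (x : ℝ) := hx
  -- The coefficients are natural numbers, so their sum `P.eval 1` serves as `C`. The bound reduces
  -- the claim to the growth of an exponential against a monomial.
  obtain ⟨d, C, hC⟩ : ∃ d C : ℕ, ∀ n : ℕ, 1 ≤ n → P.eval n ≤ C * n ^ d := by
    refine ⟨P.natDegree, P.eval 1, fun n hn => ?_⟩
    rw [Polynomial.eval_eq_sum_range, Polynomial.eval_eq_sum_range, Finset.sum_mul]
    refine Finset.sum_le_sum fun i hi => ?_
    rw [one_pow, mul_one]
    exact Nat.mul_le_mul_left _ (Nat.pow_le_pow_right hn (Finset.mem_range_succ_iff.1 hi))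
  have ht := tendsto_pow_const_div_const_pow_of_one_lt d hx'
  have ht' := (ht.const_mul (C : ℝ)).eventually_lt_const (u := 1) (by rw [mul_zero]; exact one_pos)
  obtain ⟨n, hn, hn1⟩ := (ht'.and (Filter.eventually_ge_atTop 1)).exists
  have h1 : (x : ℝ) ^ n ≤ C * (n : ℝ) ^ d := by
    have h2 : (x : ℝ) ^ n ≤ ((P.eval n : ℕ) : ℝ) := by exact_mod_cast h n
    exact h2.trans (by exact_mod_cast hC n hn1)
  have h0 : (0 : ℝ) < (x : ℝ) ^ n := by positivity
  rw [← mul_div_assoc, div_lt_one h0] at hn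
  exact hn.not_ge h1

theorem Int.ringHom_surjective (B : Type) [CommRing B] (f : B →+* ℤ) : Function.Surjective f :=
  fun n => ⟨n, by simp⟩

namespace GSeminorm.IsModeledBy

theorem mem_SpehM {F : Type*} [NormedField F] {x : Place ℤ}
    (h : x.norm.IsModeledBy (Int.castRingHom F)) : x ∈ SpehM ℤ := by
  rw [← Place.eq_ofField_iff] at h
  exact ⟨⟨ℝ≥0, ofRingHom (Int.castRingHom F)⟩, h.symm,
    (isModeledBy_ofRingHom _).isMultiplicative, NNReal.hasTemperedGrowth⟩

theorem mem_SpehA {F : Type*} [NormedField F] [CompleteSpace F] {x : Place ℤ}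
    (h : x.norm.IsModeledBy (Int.castRingHom F)) (hF : IsDenseModel (Int.castRingHom F)) :
    x ∈ SpehA ℤ :=
  ⟨h.mem_SpehM, h.hasFunctorialMulCompletion hF Int.ringHom_surjective⟩

end GSeminorm.IsModeledBy

/-! ### From the trichotomy to the standard seminorms -/

namespace GSeminorm

theorem IsMultiplicative.mulEquivalent {A R S : Type*} [CommRing A] [Semifield R] [LinearOrder R]
    [Semifield S] [LinearOrder S] {v : GSeminorm A R} {w : GSeminorm A S}
    (hv : v.IsMultiplicative) (hw : w.IsMultiplicative) (h : ∀ a b, w a ≤ w b ↔ v a ≤ v b) :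
    v.MulEquivalent w := fun a b c => by rw [← hv, ← hw, h]

section

variable {R : Type*} [Semifield R] [LinearOrder R] [IsPositiveAura R] {v : GSeminorm ℤ R}

/-- Both seminorms order integers by their absolute value, and for multiplicative seminorms the
order of values determines the class. -/
theorem mulEquivalent_arch (hv : v.IsMultiplicative) (h : StrictMono fun a : ℕ => v (a : ℤ)) :
    archSeminorm.MulEquivalent v := by
  refine IsMultiplicative.mulEquivalent (fun a b => ?_) hv fun a b => ?_
  · exact by simp [archSeminorm, Int.natAbs_mul]
  · rw [← hv.map_natAbs a, ← hv.map_natAbs b, h.le_iff_le]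
    simp [archSeminorm]

theorem mulEquivalent_residual (hv : v.IsMultiplicative) {q : ℕ} (hq : q ≠ 1)
    (hw : (residualSeminorm q hq).IsMultiplicative)
    (h0 : v q = 0) (h1 : ∀ n : ℤ, ¬(q : ℤ) ∣ n → v n = 1) :
    (residualSeminorm q hq).MulEquivalent v := by
  have key : ∀ n, v n = if (q : ℤ) ∣ n then 0 else 1 := fun n => by
    split_ifs with h
    · obtain ⟨m, rfl⟩ := h
      rw [hv, h0, zero_mul]
    · exact h1 n h
  refine IsMultiplicative.mulEquivalent hw hv fun a b => ?_
  rw [key, key]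
  simp only [residualSeminorm]
  have := (IsPositiveAura.zero_lt_one (R := R))
  split_ifs <;> simp [this.le, this]

/-- On `n = p ^ i * m` with `p ∤ m`, both seminorms are the `i`-th power of a number strictly
between `0` and `1`, so both compare non-zero integers by their multiplicity at `p`. -/
theorem mulEquivalent_padic (hv : v.IsMultiplicative) {p : ℕ} [hp : Fact p.Prime]
    (h0 : v p ≠ 0) (hp1 : v p < 1) (h1 : ∀ n : ℤ, ¬(p : ℤ) ∣ n → v n = 1) :
    (padicSeminorm p).MulEquivalent v := by
  have hm : (padicSeminorm p).IsMultiplicative := fun a b => by simp [padicSeminorm]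
  have hpow : ∀ n : ℤ, n ≠ 0 → ∃ i : ℕ, v n = v p ^ i ∧
      padicSeminorm p n = padicSeminorm p p ^ i := fun n hn => by
    obtain ⟨m, hm1, hm2⟩ := (Int.finiteMultiplicity_iff (a := (p : ℤ)) (b := n)).2
      ⟨by simpa using hp.out.ne_one, hn⟩ |>.exists_eq_pow_mul_and_not_dvd
    refine ⟨multiplicity (p : ℤ) n, ?_, ?_⟩
    · conv_lhs => rw [hm1, hv, h1 m hm2, mul_one, hv.map_pow]
    · have : padicSeminorm p m = 1 := by
        have := (Padic.norm_intCast_lt_one_iff (p := p) (k := m)).not.2 hm2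
        exact NNReal.eq (le_antisymm (Padic.norm_int_le_one m) (not_lt.1 this))
      conv_lhs => rw [hm1, hm, this, mul_one, hm.map_pow]
  have hpp : padicSeminorm p p < 1 := by
    exact (Padic.norm_intCast_lt_one_iff (p := p)).2 dvd_rfl
  have hpp0 : 0 < padicSeminorm p p := by
    exact norm_pos_iff.2 (by simpa using hp.out.ne_zero)
  have hvp : 0 < v p := IsPositiveAura.pos_iff_ne_zero.2 h0
  refine IsMultiplicative.mulEquivalent hm hv fun a b => ?_
  rcases eq_or_ne a 0 with rfl | ha
  · rw [map_zero, map_zero]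
    exact iff_of_true (IsPositiveAura.zero_le _) (IsPositiveAura.zero_le _)
  obtain ⟨i, hi, hi'⟩ := hpow a ha
  rcases eq_or_ne b 0 with rfl | hb
  · rw [map_zero, map_zero, hi, hi', IsPositiveAura.le_zero_iff, IsPositiveAura.le_zero_iff]
    exact iff_of_false (pow_ne_zero _ h0) (pow_ne_zero _ hpp0.ne')
  obtain ⟨j, hj, hj'⟩ := hpow b hb
  rw [hi, hj, hi', hj', pow_le_pow_iff_right_of_lt_one₀ hvp hp1,
    pow_le_pow_iff_right_of_lt_one₀ hpp0 hpp]

end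

end GSeminorm

theorem mem_SpehM_int_iff {x : Place ℤ} : x ∈ SpehM ℤ ↔
    x = trivialPlace ∨ x = archPlace ∨
      ∃ (p : ℕ) (_ : Fact p.Prime), x = padicPlace p ∨ x = residualPlace p := by
  constructor
  · rintro ⟨v, rfl, hv, ht⟩
    have eqv : ∀ w : GSeminorm ℤ ℝ≥0, w.MulEquivalent v.val → v.val.place = w.place :=
      fun w hw => Eq.symm (Quotient.sound hw)
    rcases hv.trichotomy ht with h | h | ⟨p, pp, hp, h⟩
    · exact Or.inr (Or.inl (eqv _ (mulEquivalent_arch hv h)))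
    · refine Or.inl (eqv _ (mulEquivalent_residual hv _ ?_ ?_ fun n hn => h n (by simpa using hn)))
      · rw [residualSeminorm_zero_eq]
        exact (isModeledBy_ofRingHom _).isMultiplicative
      · simp [v.val.map_zero]
    · have : Fact p.Prime := ⟨pp⟩
      refine Or.inr (Or.inr ⟨p, this, ?_⟩)
      by_cases h0 : v.val p = 0
      · refine Or.inr (eqv _ (mulEquivalent_residual hv _ ?_ h0 h))
        rw [residualSeminorm_prime_eq]
        exact (isModeledBy_ofRingHom _).isMultiplicative
      · exact Or.inl (eqv _ (mulEquivalent_padic hv h0 hp h))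
  · rintro (rfl | rfl | ⟨p, hp, rfl | rfl⟩)
    · rw [Place.trivialPlace_eq]; exact (Place.isModeledBy_ofField _).mem_SpehM
    · rw [Place.archPlace_eq]; exact (Place.isModeledBy_ofField _).mem_SpehM
    · rw [Place.padicPlace_eq]; exact (Place.isModeledBy_ofField _).mem_SpehM
    · rw [Place.residualPlace_eq]; exact (Place.isModeledBy_ofField _).mem_SpehM

theorem SpehA_int_eq_SpehM : SpehA ℤ = SpehM ℤ := by
  refine Set.Subset.antisymm (fun x hx => hx.1) fun x hx => ?_
  rcases mem_SpehM_int_iff.1 hx with rfl | rfl | ⟨p, hp, rfl | rfl⟩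
  · rw [Place.trivialPlace_eq]
    exact (Place.isModeledBy_ofField _).mem_SpehA isDenseModel_rat
  · rw [Place.archPlace_eq]
    exact (Place.isModeledBy_ofField _).mem_SpehA isDenseModel_real
  · rw [Place.padicPlace_eq]
    exact (Place.isModeledBy_ofField _).mem_SpehA (isDenseModel_padic p)
  · rw [Place.residualPlace_eq]
    exact (Place.isModeledBy_ofField _).mem_SpehA (isDenseModel_zmod p)

/-- Over `ℤ` the additional places of `R̃` are not new: being `ℤ`-multiplicative is being
multiplicative, and `ℝ≥0` has tempered growth, so they belong to `SpehM ℤ = SpehA ℤ`. -/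
theorem mem_rationalTilde_int_iff {x : Place ℤ} {l : List ℤ} {b : ℤ} :
    x ∈ rationalTilde l b ↔ x ∈ SpehA ℤ ∧ x.InRational l b := by
  refine ⟨fun ⟨h, h'⟩ => ⟨?_, h⟩, fun ⟨h, h'⟩ => ⟨h', Or.inl h⟩⟩
  rcases h' with h' | ⟨-, ⟨v, -, hv⟩, -, hm⟩
  · exact h'
  · have hm' : x.norm.IsMultiplicative := hm
    rw [SpehA_int_eq_SpehM]
    refine ⟨⟨ℝ≥0, v⟩, Place.place_eq_iff.2 hv, fun a b => ?_, NNReal.hasTemperedGrowth⟩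
    exact le_antisymm (v.map_mul_le a b) ((hv a (a * b) b).1 (hm' a b).ge)

/-! ### Analytic series as closures -/

section Closure

variable {A : Type*} [CommRing A] (l : List A) (b : A)

theorem PreSeries.isUniformInducing_toProd : IsUniformInducing (PreSeries.toProd l b) :=
  AddMonoidHom.isUniformInducing_of_isInducing ⟨rfl⟩

/-- The uniformity of `A[b⁻¹]` is induced from a product of complete separated rings, so the image
of its completion there is closed, and `A[b⁻¹]` is dense in it. -/
theorem AnalyticSeries.exists_eval_eq_iff
    (h : ∀ x : rationalTilde l b, ValueRing x.1 (rationalTilde.functorial x.2)) :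
    (∃ g : AnalyticSeries l b, ∀ x, AnalyticSeries.eval l b x g = h x) ↔
      h ∈ closure (Set.range (PreSeries.toProd l b)) := by
  let E : AnalyticSeries l b →
      ∀ x : rationalTilde l b, ValueRing x.1 (rationalTilde.functorial x.2) :=
    fun g x => AnalyticSeries.eval l b x g
  have hE : Continuous E :=
    continuous_pi fun x => UniformSpace.Completion.continuous_extension
  have hcoe : ∀ z : PreSeries l b, E z = PreSeries.toProd l b z := fun z => funext fun x =>
    UniformSpace.Completion.extensionHom_coe _ (PreSeries.continuous_coord l b x) _
  have hu := PreSeries.isUniformInducing_toProd l b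
  have hEx : E = UniformSpace.Completion.extension (PreSeries.toProd l b) := by
    refine UniformSpace.Completion.ext hE UniformSpace.Completion.continuous_extension fun z => ?_
    rw [hcoe, UniformSpace.Completion.extension_coe hu.uniformContinuous]
  have hcl : IsClosed (Set.range E) := by
    rw [hEx]
    exact (UniformSpace.Completion.isUniformInducing_extension hu).isComplete_range.isClosed
  constructor
  · suffices H : ∀ g, E g ∈ closure (Set.range (PreSeries.toProd l b)) by
      rintro ⟨g, hg⟩
      rw [← (funext hg : E g = h)]
      exact H g
    intro g
    induction g using UniformSpace.Completion.induction_on with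
    | hp => exact isClosed_closure.preimage hE
    | ih z => rw [hcoe]; exact subset_closure ⟨z, rfl⟩
  · intro hh
    have : h ∈ Set.range E := hcl.closure_subset_iff.2 (by
      rintro _ ⟨z, rfl⟩
      exact ⟨z, hcoe z⟩) hh
    obtain ⟨g, rfl⟩ := this
    exact ⟨g, fun x => rfl⟩

end Closure

/-! ### Residue fields at the points of the spectrum of `ℤ` -/

/-- The point `x` is the place defined by the norm of `F`. -/
abbrev IsPlaceOf (x : Place ℤ) (F : Type*) [NormedField F] : Prop :=
  x.norm.IsModeledBy (Int.castRingHom F)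

theorem IsPlaceOf.unique {F : Type*} [NormedField F] {x y : Place ℤ} (hx : IsPlaceOf x F)
    (hy : IsPlaceOf y F) : x = y := by
  rw [Place.eq_ofField_iff.2 hx, Place.eq_ofField_iff.2 hy]

theorem IsPlaceOf.inRational_iff {F : Type*} [NormedField F] {x : Place ℤ} (hx : IsPlaceOf x F)
    {l : List ℤ} {b : ℤ} :
    x.InRational l b ↔ (∀ a ∈ l, ‖(a : F)‖ < ‖(b : F)‖) ∧ (b : F) ≠ 0 := by
  rw [SpehM.inRational_iff hx.mem_SpehM]
  exact and_congr (forall₂_congr fun a _ => hx.lt_iff) hx.eq_zero_iff.not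

/-- Uniqueness of morphisms from `ℤ[1/b]` makes all compatibilities of evaluation maps with models
automatic. -/
theorem Localization.Away.int_ringHom_ext {b : ℤ} {S : Type*} [CommRing S]
    (f g : Localization.Away b →+* S) : f = g :=
  IsLocalization.ringHom_ext (Submonoid.powers b) (RingHom.ext_int _ _)

theorem exists_isPlaceOf {x : Place ℤ} (hx : x ∈ SpehA ℤ) :
    IsPlaceOf x (TrivNorm ℚ) ∨ IsPlaceOf x ℝ ∨
      ∃ (p : ℕ) (_ : Fact p.Prime), IsPlaceOf x ℚ_[p] ∨ IsPlaceOf x (TrivNorm (ZMod p)) := by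
  rcases mem_SpehM_int_iff.1 hx.1 with h | h | ⟨p, hp, h | h⟩
  · rw [Place.trivialPlace_eq, Place.eq_ofField_iff] at h
    exact Or.inl h
  · rw [Place.archPlace_eq, Place.eq_ofField_iff] at h
    exact Or.inr (Or.inl h)
  · rw [Place.padicPlace_eq, Place.eq_ofField_iff] at h
    exact Or.inr (Or.inr ⟨p, hp, Or.inl h⟩)
  · rw [Place.residualPlace_eq, Place.eq_ofField_iff] at h
    exact Or.inr (Or.inr ⟨p, hp, Or.inr h⟩)

section ValueEquiv

variable {F : Type*} [NormedField F] [CompleteSpace F] {x : Place ℤ}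

/-- The value ring at the place defined by the norm of `F` is `F`. -/
noncomputable def valueEquiv (h : IsPlaceOf x F) (hF : IsDenseModel (Int.castRingHom F))
    (hx : x.norm.HasFunctorialMulCompletion) : ValueRing x hx ≃+* F :=
  h.completionEquiv hF hx.hasMulTinyBalls

theorem isHomeomorph_valueEquiv (h : IsPlaceOf x F) (hF : IsDenseModel (Int.castRingHom F))
    (hx : x.norm.HasFunctorialMulCompletion) : IsHomeomorph (valueEquiv h hF hx) :=
  h.isHomeomorph_completionEquiv hF hx.hasMulTinyBalls

theorem continuous_valueEquiv (h : IsPlaceOf x F) (hF : IsDenseModel (Int.castRingHom F))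
    (hx : x.norm.HasFunctorialMulCompletion) : Continuous (valueEquiv h hF hx) :=
  (isHomeomorph_valueEquiv h hF hx).continuous

theorem valueEquiv_awayToValueRing (h : IsPlaceOf x F) (hF : IsDenseModel (Int.castRingHom F))
    (hx : x.norm.HasFunctorialMulCompletion) {b : ℤ} (hb : b ∈ x.norm.mulElts)
    (g : Localization.Away b →+* F) (z : Localization.Away b) :
    valueEquiv h hF hx (awayToValueRing x hx b hb z) = g z :=
  RingHom.congr_fun (Localization.Away.int_ringHom_ext
    (((valueEquiv h hF hx) : ValueRing x hx →+* F).comp (awayToValueRing x hx b hb)) g) z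

theorem denseRange_awayToValueRing (h : IsPlaceOf x F) (hF : IsDenseModel (Int.castRingHom F))
    (hx : x.norm.HasFunctorialMulCompletion) {b : ℤ} (hb : b ∈ x.norm.mulElts)
    {g : Localization.Away b →+* F} (hg : DenseRange g) :
    DenseRange (awayToValueRing x hx b hb) := by
  let e := (isHomeomorph_valueEquiv h hF hx).homeomorph
  have h1 : DenseRange (e.symm ∘ g) := e.symm.surjective.denseRange.comp hg e.symm.continuous
  convert h1 using 1
  funext z
  apply e.injective
  rw [Function.comp_apply, e.apply_symm_apply]
  exact valueEquiv_awayToValueRing h hF hx hb g z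

end ValueEquiv

/-! ### Analytic functions -/

/-- The point of the analytic spectrum defined by a point of `R̃`. -/
def rationalTilde.toSpehA {l : List ℤ} {b : ℤ} (x : rationalTilde l b) : SpehA ℤ :=
  ⟨x.1, (mem_rationalTilde_int_iff.1 x.2).1⟩

theorem rationalTilde.toSpehA_mem {l : List ℤ} {b : ℤ} (x : rationalTilde l b) :
    rationalTilde.toSpehA x ∈ rationalDomain l b := (mem_rationalTilde_int_iff.1 x.2).2

/-- The restriction of a family on `U` to `R̃`, for `R ⊆ U`. -/
def restrictTilde {U : Set (SpehA ℤ)} (f : ∀ x : U, ResidueField x.1) {l : List ℤ} {b : ℤ}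
    (hR : rationalDomain l b ⊆ U) (x : rationalTilde l b) :
    ValueRing x.1 (rationalTilde.functorial x.2) :=
  f ⟨rationalTilde.toSpehA x, hR (rationalTilde.toSpehA_mem x)⟩

/-- As `R̃` has the points of `R`, a family on `R` is already a full element of the product over
`R̃`, and its coming from a series is a closure condition. -/
theorem isAnalyticOn_iff_closure {U : Set (SpehA ℤ)} {f : ∀ x : U, ResidueField x.1} :
    IsAnalyticOn U f ↔ ∀ x₀ ∈ U, ∃ (l : List ℤ) (b : ℤ) (hR : rationalDomain l b ⊆ U),
      x₀ ∈ rationalDomain l b ∧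
        restrictTilde f hR ∈ closure (Set.range (PreSeries.toProd l b)) := by
  refine forall₂_congr fun x₀ _ => exists_congr fun l => exists_congr fun b =>
    exists_congr fun hR => and_congr_right fun _ => ?_
  rw [← AnalyticSeries.exists_eval_eq_iff]
  refine exists_congr fun g => ⟨fun h x => ?_, fun h x hx => ?_⟩
  · exact (h _ (rationalTilde.toSpehA_mem x)).symm
  · exact (h ⟨x.1, mem_rationalTilde hx⟩).symm

/-- Over a one-point domain the product is a single residue field, in which `ℤ[1/b]` is dense, so
the closure condition is empty. -/
theorem isAnalyticOn_of_rationalDomain_eq_singleton {x : SpehA ℤ} {l : List ℤ} {b : ℤ}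
    (hx : rationalDomain l b = {x}) (hb : b ∈ x.1.norm.mulElts)
    (hd : DenseRange (awayToValueRing x.1 x.2.2 b hb)) {U : Set (SpehA ℤ)}
    (hU : U = rationalDomain l b)
    (f : ∀ y : U, ResidueField y.1) : IsAnalyticOn U f := by
  classical
  refine isAnalyticOn_iff_closure.2 fun x₀ hx₀ => ⟨l, b, hU.ge, hU ▸ hx₀, ?_⟩
  have hxR : x ∈ rationalDomain l b := by rw [hx]; rfl
  let x' : rationalTilde l b := ⟨x.1, mem_rationalTilde hxR⟩
  have hx' : ∀ y : rationalTilde l b, y = x' := fun y => by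
    have := rationalTilde.toSpehA_mem y
    rw [hx] at this
    exact Subtype.ext (congrArg (fun t : SpehA ℤ => t.1) (Set.mem_singleton_iff.1 this))
  set h := restrictTilde f hU.ge
  -- This exhibits `h` as a continuous function of its only coordinate, to which density applies.
  rw [← Function.update_eq_self x' h]
  refine hd.induction_on (p := fun t => Function.update h x' t ∈ closure _) (h x') ?_ fun z => ?_
  · have hc : Continuous fun t => Function.update h x' t :=
      continuous_const.update x' continuous_id
    exact isClosed_closure.preimage hc
  · refine subset_closure ⟨z, funext fun y => ?_⟩
    obtain rfl := hx' y
    rw [Function.update_self]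
    rfl

/-! ### The points of a prime number -/

section Prime

variable (p : ℕ) [hp : Fact p.Prime]

/-- The reduction of `p`-adic integers. -/
noncomputable def padicReduction : ℤ_[p] →+* TrivNorm (ZMod p) :=
  (RingEquiv.toRingHom (WithAbs.equiv _).symm).comp PadicInt.toZMod

/-- The reduction is constant on open balls of radius `1`, since its kernel is the maximal ideal. -/
theorem continuous_padicReduction : Continuous (padicReduction p) := by
  have hz : ∀ y : ℤ_[p], ‖y‖ < 1 → padicReduction p y = 0 := fun y hy => by
    have : PadicInt.toZMod y = 0 := by
      rw [← RingHom.mem_ker, PadicInt.ker_toZMod, PadicInt.maximalIdeal_eq_span_p,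
        Ideal.mem_span_singleton]
      exact PadicInt.norm_lt_one_iff_dvd y |>.1 hy
    simp [padicReduction, this]
  refine continuous_iff_continuousAt.2 fun x => ?_
  refine (continuousAt_const (y := padicReduction p x)).congr ?_
  filter_upwards [Metric.ball_mem_nhds x one_pos] with y hy
  have := hz (y - x) (by simpa [dist_eq_norm] using hy)
  rw [map_sub, sub_eq_zero] at this
  exact this.symm

/-- The pairs of a `p`-adic integer and of its reduction. -/
theorem isClosed_range_padicReduction :
    IsClosed (Set.range fun w : ℤ_[p] => ((w : ℚ_[p]), padicReduction p w)) :=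
  have h : Continuous fun w : ℤ_[p] => (w : ℚ_[p]) := continuous_subtype_val
  (isCompact_range (h.prodMk (continuous_padicReduction p))).isClosed

variable {p}

theorem padic_norm_intCast_eq_one {n : ℤ} (h : (n : TrivNorm (ZMod p)) ≠ 0) :
    ‖(n : ℚ_[p])‖ = 1 := by
  refine le_antisymm (Padic.norm_int_le_one n) (not_lt.1 fun h1 => h ?_)
  have h2 := (ZMod.intCast_zmod_eq_zero_iff_dvd n p).2 (Padic.norm_intCast_lt_one_iff.1 h1)
  apply (WithAbs.equiv _).injective
  simpa using h2

theorem padic_norm_intCast_lt_one {n : ℤ} (h : (n : TrivNorm (ZMod p)) = 0) :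
    ‖(n : ℚ_[p])‖ < 1 := by
  have h1 := congrArg (WithAbs.equiv _) h
  rw [map_intCast, RingEquiv.map_zero, ZMod.intCast_zmod_eq_zero_iff_dvd] at h1
  exact Padic.norm_intCast_lt_one_iff.2 h1

/-- A rational domain that contains the place `|.|_{p,0}` contains the place `|.|_p`. -/
theorem IsPlaceOf.inRational_padic {x y : Place ℤ} (hx : IsPlaceOf x (TrivNorm (ZMod p)))
    (hy : IsPlaceOf y ℚ_[p]) {l : List ℤ} {b : ℤ} (h : x.InRational l b) : y.InRational l b := by
  rw [hx.inRational_iff] at h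
  rw [hy.inRational_iff, ← norm_ne_zero_iff, padic_norm_intCast_eq_one h.2]
  -- At `|.|_{p,0}` the condition reads `p ∣ a` and `p ∤ b`, which gives `|a|_p < 1 = |b|_p`.
  refine ⟨fun a ha => padic_norm_intCast_lt_one (TrivNorm.eq_zero_of_norm_lt_one ?_), one_ne_zero⟩
  rw [← TrivNorm.norm_of_ne_zero h.2]
  exact h.1 a ha

theorem IsPlaceOf.mem_of_isOpen {x y : SpehA ℤ} (hx : IsPlaceOf x.1 (TrivNorm (ZMod p)))
    (hy : IsPlaceOf y.1 ℚ_[p]) {U : Set (SpehA ℤ)} (hU : IsOpen U) (h : x ∈ U) : y ∈ U := by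
  obtain ⟨l, b, hxR, hR⟩ := exists_rationalDomain_subset hU h
  exact hR (hx.inRational_padic hy hxR)

/-- Lying on the graph of the reduction is a closed condition on the two coordinates. It holds on
`ℤ[1/b]`, because `b` is prime to `p` and so a unit of `ℤ_[p]`. -/
theorem exists_padicInt_of_mem_closure {x y : Place ℤ} (hx : IsPlaceOf x (TrivNorm (ZMod p)))
    (hy : IsPlaceOf y ℚ_[p]) {l : List ℤ} {b : ℤ} (hxR : x ∈ rationalTilde l b)
    (hyR : y ∈ rationalTilde l b)
    {h : ∀ x : rationalTilde l b, ValueRing x.1 (rationalTilde.functorial x.2)}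
    (hh : h ∈ closure (Set.range (PreSeries.toProd l b))) :
    ∃ w : ℤ_[p], valueEquiv hy (isDenseModel_padic p) _ (h ⟨y, hyR⟩) = w ∧
      valueEquiv hx (isDenseModel_zmod p) _ (h ⟨x, hxR⟩) = padicReduction p w := by
  have key : (valueEquiv hy (isDenseModel_padic p) _ (h ⟨y, hyR⟩),
      valueEquiv hx (isDenseModel_zmod p) _ (h ⟨x, hxR⟩)) ∈
        Set.range fun w : ℤ_[p] => ((w : ℚ_[p]), padicReduction p w) := by
    have hc : Continuous fun h : ∀ x : rationalTilde l b,
        ValueRing x.1 (rationalTilde.functorial x.2) =>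
        (valueEquiv hy (isDenseModel_padic p) _ (h ⟨y, hyR⟩),
          valueEquiv hx (isDenseModel_zmod p) _ (h ⟨x, hxR⟩)) :=
      ((continuous_valueEquiv _ _ _).comp (continuous_apply _)).prodMk
        ((continuous_valueEquiv _ _ _).comp (continuous_apply _))
    refine ((isClosed_range_padicReduction p).preimage hc).closure_subset_iff.2 ?_ hh
    rintro _ ⟨z, rfl⟩
    have hb : IsUnit ((algebraMap ℤ ℤ_[p]) b) := by
      rw [PadicInt.isUnit_iff]
      simpa using padic_norm_intCast_eq_one (hx.inRational_iff.1 hxR.1).2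
    let ρ : Localization.Away b →+* ℤ_[p] := IsLocalization.Away.lift b hb
    refine ⟨ρ z, Prod.ext ?_ ?_⟩
    · exact (valueEquiv_awayToValueRing hy (isDenseModel_padic p) _ (hyR.1.2 b dvd_rfl)
        ((PadicInt.Coe.ringHom).comp ρ) z).symm
    · exact (valueEquiv_awayToValueRing hx (isDenseModel_zmod p) _ (hxR.1.2 b dvd_rfl)
        ((padicReduction p).comp ρ) z).symm
  obtain ⟨w, hw⟩ := key
  exact ⟨w, (congrArg Prod.fst hw).symm, (congrArg Prod.snd hw).symm⟩

/-- The value at `|.|_p` of an analytic function around `|.|_{p,0}` is a `p`-adic integer, and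
its value at `|.|_{p,0}` is the reduction of that integer. -/
theorem IsAnalyticOn.exists_padicInt {x y : SpehA ℤ} (hx : IsPlaceOf x.1 (TrivNorm (ZMod p)))
    (hy : IsPlaceOf y.1 ℚ_[p]) {U : Set (SpehA ℤ)} {f : ∀ x : U, ResidueField x.1}
    (hf : IsAnalyticOn U f) (hxU : x ∈ U) (hyU : y ∈ U) :
    ∃ w : ℤ_[p], valueEquiv hy (isDenseModel_padic p) y.2.2 (f ⟨y, hyU⟩) = w ∧
      valueEquiv hx (isDenseModel_zmod p) x.2.2 (f ⟨x, hxU⟩) = padicReduction p w := by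
  obtain ⟨l, b, hR, hxR, hcl⟩ := isAnalyticOn_iff_closure.1 hf x hxU
  exact exists_padicInt_of_mem_closure hx hy (mem_rationalTilde hxR)
    (mem_rationalTilde (hx.inRational_padic hy hxR)) hcl

end Prime

/-! ### The trivial place -/

instance TrivNorm.charZero : CharZero (TrivNorm ℚ) :=
  charZero_of_injective_ringHom (f := RingEquiv.toRingHom (WithAbs.equiv _).symm)
    (WithAbs.equiv _).symm.injective

theorem IsPlaceOf.inRational_trivial_iff {x : Place ℤ} (hx : IsPlaceOf x (TrivNorm ℚ))
    {l : List ℤ} {b : ℤ} : x.InRational l b ↔ (∀ a ∈ l, a = 0) ∧ b ≠ 0 := by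
  rw [hx.inRational_iff, Int.cast_ne_zero]
  refine and_congr_left fun hb => forall₂_congr fun a _ => ?_
  rw [TrivNorm.norm_of_ne_zero (Int.cast_ne_zero.2 hb)]
  constructor
  · intro h
    exact_mod_cast TrivNorm.eq_zero_of_norm_lt_one h
  · rintro rfl
    simp

theorem Place.mem_rationalDomain_of_forall_eq_zero {x : SpehA ℤ} {l : List ℤ} {b : ℤ}
    (hl : ∀ a ∈ l, a = 0) (hb : x.1.norm b ≠ 0) : x ∈ rationalDomain l b := by
  refine (SpehM.inRational_iff x.2.1).2 ⟨fun a ha => ?_, hb⟩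
  rw [hl a ha, x.1.norm.map_zero]
  exact IsPositiveAura.pos_iff_ne_zero.2 hb

theorem IsPlaceOf.mem_rationalDomain {F : Type*} [NormedField F] [CharZero F] {x : SpehA ℤ}
    (hx : IsPlaceOf x.1 F) {l : List ℤ} {b : ℤ} (hl : ∀ a ∈ l, a = 0) (hb : b ≠ 0) :
    x ∈ rationalDomain l b :=
  Place.mem_rationalDomain_of_forall_eq_zero hl (hx.eq_zero_iff.not.2 (by simpa using hb))

theorem mem_nonvanishing {x : SpehA ℤ} {m : ℤ} : x ∈ nonvanishing m ↔ x.1.norm m ≠ 0 :=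
  IsPositiveAura.pos_iff_ne_zero

theorem rationalDomain_zero_eq (m : ℤ) :
    rationalDomain [0] m = (nonvanishing m : Set (SpehA ℤ)) := by
  ext x
  rw [SetLike.mem_coe, mem_nonvanishing]
  refine ⟨fun h => ((SpehM.inRational_iff x.2.1).1 h).2, fun h => ?_⟩
  exact Place.mem_rationalDomain_of_forall_eq_zero (by simp) h

/-- The embedding of `ℤ[b⁻¹]` in `ℚ`. -/
noncomputable def awayToRat {b : ℤ} (hb : b ≠ 0) : Localization.Away b →+* ℚ :=
  IsLocalization.Away.lift b (g := Int.castRingHom ℚ)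
    (isUnit_iff_ne_zero.2 (Int.cast_ne_zero.2 hb))

theorem awayToRat_injective {b : ℤ} (hb : b ≠ 0) : Function.Injective (awayToRat hb) := by
  refine (injective_iff_map_eq_zero _).2 fun z hz => ?_
  obtain ⟨a, s, rfl⟩ := IsLocalization.exists_mk'_eq (Submonoid.powers b) z
  rw [awayToRat, IsLocalization.Away.lift, IsLocalization.lift_mk'_spec, mul_zero] at hz
  obtain rfl : a = 0 := by simpa using hz
  exact IsLocalization.mk'_zero _

theorem exists_dvd_pow_of_forall_prime_dvd {n : ℕ} (hn : n ≠ 0) {m : ℕ}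
    (h : ∀ q : ℕ, q.Prime → q ∣ n → q ∣ m) : ∃ k, n ∣ m ^ k := by
  induction n using Nat.recOnMul with
  | zero => exact absurd rfl hn
  | one => exact ⟨0, by simp⟩
  | prime p pp => exact ⟨1, by simpa using h p pp dvd_rfl⟩
  | mul a b ha hb =>
    obtain ⟨k, hk⟩ := ha (left_ne_zero_of_mul hn) fun q hq hqa => h q hq (hqa.mul_right b)
    obtain ⟨j, hj⟩ := hb (right_ne_zero_of_mul hn) fun q hq hqb => h q hq (hqb.mul_left a)
    exact ⟨k + j, by rw [pow_add]; exact mul_dvd_mul hk hj⟩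

/-- If `p` divided the denominator, `num = s * den` would have norm less than `1`, so `p` would
divide the numerator too. -/
theorem Padic.not_dvd_den_of_norm_le_one {p : ℕ} [hp : Fact p.Prime] {s : ℚ}
    (hs : ‖(s : ℚ_[p])‖ ≤ 1) : ¬p ∣ s.den := by
  intro hd
  have h1 : ‖((s.den : ℤ) : ℚ_[p])‖ < 1 :=
    Padic.norm_intCast_lt_one_iff.2 (Int.natCast_dvd_natCast.2 hd)
  have h2 : ((s.num : ℤ) : ℚ_[p]) = s * ((s.den : ℤ) : ℚ_[p]) := by
    exact_mod_cast (Rat.mul_den_eq_num s).symm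
  have h3 : ‖((s.num : ℤ) : ℚ_[p])‖ < 1 := by
    rw [h2, norm_mul]
    exact (mul_le_of_le_one_left (norm_nonneg _) hs).trans_lt h1
  have h4 := Int.natAbs_dvd_natAbs.2 (Padic.norm_intCast_lt_one_iff.1 h3)
  rw [Int.natAbs_natCast] at h4
  exact Nat.not_coprime_of_dvd_of_dvd hp.out.one_lt h4 hd s.reduced

/-- Integrality outside `m` confines the primes of the denominator to those of `m`, so the
denominator divides some `m ^ k`. -/
theorem exists_awayToRat_eq {m : ℤ} (hm : m ≠ 0) {s : ℚ}
    (h : ∀ (q : ℕ) [Fact q.Prime], ¬(q : ℤ) ∣ m → ‖(s : ℚ_[q])‖ ≤ 1) :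
    ∃ z, awayToRat hm z = s := by
  obtain ⟨k, hk⟩ := exists_dvd_pow_of_forall_prime_dvd s.den_ne_zero (m := m.natAbs)
    fun q hq hqd => by
      by_contra hqm
      have : Fact q.Prime := ⟨hq⟩
      exact Padic.not_dvd_den_of_norm_le_one
        (h q fun h' => hqm (by simpa using Int.natAbs_dvd_natAbs.2 h')) hqd
  have hk' : (s.den : ℤ) ∣ m ^ k := by
    rw [← Int.natAbs_dvd_natAbs, Int.natAbs_pow]
    exact hk
  obtain ⟨c, hc⟩ := hk'
  refine ⟨IsLocalization.mk' _ (s.num * c) (⟨m ^ k, k, rfl⟩ : Submonoid.powers m), ?_⟩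
  rw [awayToRat, IsLocalization.Away.lift, IsLocalization.lift_mk'_spec]
  simp only [eq_intCast, hc]
  have := Rat.mul_den_eq_num s
  push_cast
  rw [← this]
  ring

section Trivial

variable {x : Place ℤ} (hx : IsPlaceOf x (TrivNorm ℚ))
include hx

theorem IsPlaceOf.discreteTopology (hf : x.norm.HasFunctorialMulCompletion) :
    DiscreteTopology (ValueRing x hf) :=
  DiscreteTopology.of_continuous_injective (continuous_valueEquiv hx isDenseModel_rat hf)
    (valueEquiv hx isDenseModel_rat hf).injective

theorem IsPlaceOf.awayToValueRing_injective (hf : x.norm.HasFunctorialMulCompletion) {b : ℤ}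
    (hb : b ∈ x.norm.mulElts) : Function.Injective (awayToValueRing x hf b hb) := by
  have hb0 : b ≠ 0 := by
    rintro rfl
    exact hx.mem_mulElts.1 hb (by simp)
  intro z w hzw
  have h := congrArg (valueEquiv hx isDenseModel_rat hf) hzw
  let g : Localization.Away b →+* TrivNorm ℚ :=
    (RingEquiv.toRingHom (WithAbs.equiv _).symm).comp (awayToRat hb0)
  rw [valueEquiv_awayToValueRing _ _ _ _ g, valueEquiv_awayToValueRing _ _ _ _ g] at h
  exact awayToRat_injective hb0 ((WithAbs.equiv _).symm.injective h)

/-- Prescribing the coordinate at the trivial place is an open condition, its residue field being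
discrete, and by injectivity at most one element of `ℤ[1/b]` meets it. So `h` is in the closure of
one point. -/
theorem IsPlaceOf.exists_eq_toProd {l : List ℤ} {b : ℤ} (hxR : x ∈ rationalTilde l b)
    {h : ∀ x : rationalTilde l b, ValueRing x.1 (rationalTilde.functorial x.2)}
    (hh : h ∈ closure (Set.range (PreSeries.toProd l b))) : ∃ z, PreSeries.toProd l b z = h := by
  have hd := hx.discreteTopology (rationalTilde.functorial hxR)
  set W : Set (∀ x : rationalTilde l b, ValueRing x.1 (rationalTilde.functorial x.2)) :=
    (fun h' => h' ⟨x, hxR⟩) ⁻¹' {h ⟨x, hxR⟩} with hW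
  have hWo : IsOpen W := (isOpen_discrete _).preimage (continuous_apply _)
  have hcl := hWo.inter_closure ⟨rfl, hh⟩
  obtain ⟨_, hz, z, rfl⟩ := closure_nonempty_iff.1 ⟨h, hcl⟩
  refine ⟨z, ?_⟩
  have hs : W ∩ Set.range (PreSeries.toProd l b) ⊆ {PreSeries.toProd l b z} := by
    rintro _ ⟨hw, w, rfl⟩
    rw [Set.mem_singleton_iff]
    congr 1
    have hzw : PreSeries.toProd l b w ⟨x, hxR⟩ = PreSeries.toProd l b z ⟨x, hxR⟩ :=
      (Set.mem_singleton_iff.1 hw).trans (Set.mem_singleton_iff.1 hz).symm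
    exact hx.awayToValueRing_injective _ (hxR.1.2 b dvd_rfl) hzw
  have := closure_mono hs hcl
  rw [closure_singleton] at this
  exact (Set.mem_singleton_iff.1 this).symm

end Trivial

/-- An analytic function around the trivial place is given by a rational number at all the
places of characteristic zero. -/
theorem IsAnalyticOn.exists_rat {x : SpehA ℤ} (hx : IsPlaceOf x.1 (TrivNorm ℚ))
    {U : Set (SpehA ℤ)} {f : ∀ x : U, ResidueField x.1} (hf : IsAnalyticOn U f) (hxU : x ∈ U) :
    ∃ s : ℚ, ∀ (y : SpehA ℤ) (hy : y ∈ U) (F : Type) [NormedField F] [CompleteSpace F]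
      [CharZero F] (h : IsPlaceOf y.1 F) (hF : IsDenseModel (Int.castRingHom F)),
      valueEquiv h hF y.2.2 (f ⟨y, hy⟩) = s := by
  obtain ⟨l, b, hR, hxR, hcl⟩ := isAnalyticOn_iff_closure.1 hf x hxU
  obtain ⟨hl, hb⟩ := hx.inRational_trivial_iff.1 hxR
  obtain ⟨z, hz⟩ := hx.exists_eq_toProd (mem_rationalTilde hxR) hcl
  refine ⟨awayToRat hb z, fun y hy F _ _ _ h hF => ?_⟩
  -- A rational domain around the trivial place has all `a_i = 0` and `b ≠ 0`, so it contains every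
  -- place of characteristic zero; one `z` serves for all of them.
  have hyR := h.mem_rationalDomain hl hb
  have := congrFun hz ⟨y.1, mem_rationalTilde hyR⟩
  change _ = f ⟨y, hy⟩ at this
  rw [← this]
  exact valueEquiv_awayToValueRing h hF y.2.2 (hyR.2 b dvd_rfl)
    ((Rat.castHom F).comp (awayToRat hb)) z

/-- The place `|.|_p` is a point of the analytic spectrum. -/
theorem exists_padic_point (p : ℕ) [Fact p.Prime] : ∃ y : SpehA ℤ, IsPlaceOf y.1 ℚ_[p] :=
  ⟨⟨_, (Place.isModeledBy_ofField ℚ_[p]).mem_SpehA (isDenseModel_padic p)⟩,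
    Place.isModeledBy_ofField _⟩

theorem exists_residual_point (p : ℕ) [Fact p.Prime] :
    ∃ y : SpehA ℤ, IsPlaceOf y.1 (TrivNorm (ZMod p)) :=
  ⟨⟨_, (Place.isModeledBy_ofField _).mem_SpehA (isDenseModel_zmod p)⟩,
    Place.isModeledBy_ofField _⟩

theorem exists_trivial_point : ∃ y : SpehA ℤ, IsPlaceOf y.1 (TrivNorm ℚ) :=
  ⟨⟨_, (Place.isModeledBy_ofField _).mem_SpehA isDenseModel_rat⟩,
    Place.isModeledBy_ofField _⟩

section EvalTrivial

variable {x : SpehA ℤ} (hx : IsPlaceOf x.1 (TrivNorm ℚ)) {U : TopologicalSpace.Opens (SpehA ℤ)}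
  (hxU : x ∈ U)

/-- The value at the trivial place of an analytic function. -/
noncomputable def evalTrivial : analyticFunctions U →+* ℚ :=
  (RingEquiv.toRingHom (WithAbs.equiv _)).comp
    ((RingEquiv.toRingHom (valueEquiv hx isDenseModel_rat x.2.2)).comp
      ((Pi.evalRingHom (fun y : (U : Set (SpehA ℤ)) => ResidueField y.1) ⟨x, hxU⟩).comp
        (analyticFunctions U).subtype))

theorem valueEquiv_eq_evalTrivial (f : analyticFunctions U) {y : SpehA ℤ} (hy : y ∈ U) {F : Type}
    [NormedField F] [CompleteSpace F] [CharZero F] (h : IsPlaceOf y.1 F)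
    (hF : IsDenseModel (Int.castRingHom F)) :
    valueEquiv h hF y.2.2 (f.1 ⟨y, hy⟩) = (evalTrivial hx hxU f : ℚ) := by
  obtain ⟨s, hs⟩ := IsAnalyticOn.exists_rat hx f.2 hxU
  rw [hs y hy F h hF]
  have h1 : evalTrivial hx hxU f = s := by
    change WithAbs.equiv _ (valueEquiv hx isDenseModel_rat x.2.2 (f.1 ⟨x, hxU⟩)) = s
    rw [hs x hxU _ hx]
    exact map_ratCast _ s
  rw [h1]

/-- A zero value at the trivial place forces zero at all places of characteristic zero. At
`|.|_{p,0}` the value is the reduction of the value at `|.|_p`, which is then zero. -/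
theorem evalTrivial_injective : Function.Injective (evalTrivial hx hxU) := by
  refine (injective_iff_map_eq_zero _).2 fun f hf => ?_
  have h0 : ∀ {y : SpehA ℤ} (hy : y ∈ U) {F : Type} [NormedField F] [CompleteSpace F] [CharZero F]
      (_ : IsPlaceOf y.1 F) (_ : IsDenseModel (Int.castRingHom F)), f.1 ⟨y, hy⟩ = 0 := by
    intro y hy F _ _ _ h hF
    apply (valueEquiv h hF y.2.2).injective
    rw [valueEquiv_eq_evalTrivial hx hxU f hy h hF, hf, Rat.cast_zero, RingEquiv.map_zero]
  refine Subtype.ext (funext fun ⟨y, hy⟩ => ?_)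
  rcases exists_isPlaceOf y.2 with h | h | ⟨p, hp, h | h⟩
  · exact h0 hy h isDenseModel_rat
  · exact h0 hy h isDenseModel_real
  · exact h0 hy h (isDenseModel_padic p)
  · obtain ⟨t, ht⟩ := exists_padic_point p
    have htU : t ∈ U := h.mem_of_isOpen ht U.isOpen hy
    obtain ⟨w, hw, hw'⟩ := IsAnalyticOn.exists_padicInt h ht f.2 hy htU
    rw [h0 htU ht (isDenseModel_padic p), RingEquiv.map_zero] at hw
    have hw0 : w = 0 := Subtype.ext hw.symm
    rw [hw0, RingHom.map_zero] at hw'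
    apply (valueEquiv h (isDenseModel_zmod p) y.2.2).injective
    rw [hw']
    exact (RingEquiv.map_zero _).symm

/-- Being defined at `|.|_{p,0}` makes the value at `|.|_p` a `p`-adic integer, and that value is
the same rational number. -/
theorem norm_evalTrivial_le_one (f : analyticFunctions U) {p : ℕ} [Fact p.Prime] {y : SpehA ℤ}
    (h : IsPlaceOf y.1 (TrivNorm (ZMod p))) (hy : y ∈ U) :
    ‖(evalTrivial hx hxU f : ℚ_[p])‖ ≤ 1 := by
  obtain ⟨t, ht⟩ := exists_padic_point p
  have htU : t ∈ U := h.mem_of_isOpen ht U.isOpen hy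
  obtain ⟨w, hw, -⟩ := IsAnalyticOn.exists_padicInt h ht f.2 hy htU
  rw [← valueEquiv_eq_evalTrivial hx hxU f htU ht (isDenseModel_padic p), hw]
  exact w.2

include hx hxU in
theorem discreteTopology_analyticFunctions : DiscreteTopology (analyticFunctions U) := by
  let g : analyticFunctions U → TrivNorm ℚ :=
    fun f => valueEquiv hx isDenseModel_rat x.2.2 (f.1 ⟨x, hxU⟩)
  have hc : Continuous g := (continuous_valueEquiv hx isDenseModel_rat x.2.2).comp
    ((continuous_apply _).comp continuous_subtype_val)
  exact DiscreteTopology.of_continuous_injective hc fun f f' hff =>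
    evalTrivial_injective hx hxU (congrArg (WithAbs.equiv _) hff)

end EvalTrivial

/-! ### Sections on the complement of a divisor -/

section Nonvanishing

variable (m : ℤ)

/-- The elements of `ℤ[m⁻¹]` as analytic functions on `{x | 0 < |m(x)|}`. -/
noncomputable def awayToAnalytic : Localization.Away m →+* analyticFunctions (nonvanishing m) :=
  (RingHom.pi fun y : (nonvanishing m : Set (SpehA ℤ)) =>
    awayToValueRing y.1.1 y.1.2.2 m
      ((SpehM.isMultiplicative y.1.2.1).mem_mulElts.2 (mem_nonvanishing.1 y.2))).codRestrict
    (analyticFunctions (nonvanishing m)) fun z => by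
      refine isAnalyticOn_iff_closure.2 fun y hy => ⟨[0], m, (rationalDomain_zero_eq m).le,
        (rationalDomain_zero_eq m).ge hy, subset_closure ⟨z, rfl⟩⟩

variable {m}

theorem mem_nonvanishing_of_isPlaceOf {F : Type*} [NormedField F] {x : SpehA ℤ}
    (hx : IsPlaceOf x.1 F) : x ∈ nonvanishing m ↔ (m : F) ≠ 0 :=
  mem_nonvanishing.trans hx.eq_zero_iff.not

/-- Both rings embed compatibly in `ℚ`. The place `|.|_{q,0}` lies in the open set for each prime `q
∤ m`, so the values of functions are `q`-integral there and belong to `ℤ[1/m]`. -/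
theorem awayToAnalytic_bijective (hm : m ≠ 0) : Function.Bijective (awayToAnalytic m) := by
  obtain ⟨x, hx⟩ := exists_trivial_point
  have hxU : x ∈ nonvanishing m :=
    (mem_nonvanishing_of_isPlaceOf hx).2 (Int.cast_ne_zero.2 hm)
  have hcomp : ∀ z, evalTrivial hx hxU (awayToAnalytic m z) = awayToRat hm z := fun z =>
    RingHom.congr_fun (Localization.Away.int_ringHom_ext
      ((evalTrivial hx hxU).comp (awayToAnalytic m)) (awayToRat hm)) z
  constructor
  · intro z w h
    apply awayToRat_injective hm
    rw [← hcomp, ← hcomp, h]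
  · intro f
    obtain ⟨z, hz⟩ := exists_awayToRat_eq hm (s := evalTrivial hx hxU f) fun q _ hq => by
      obtain ⟨y, hy⟩ := exists_residual_point q
      refine norm_evalTrivial_le_one hx hxU f hy ((mem_nonvanishing_of_isPlaceOf hy).2 fun h => ?_)
      have h1 := congrArg (WithAbs.equiv _) h
      rw [map_intCast, RingEquiv.map_zero, ZMod.intCast_zmod_eq_zero_iff_dvd] at h1
      exact hq h1
    exact ⟨z, evalTrivial_injective hx hxU ((hcomp z).trans hz)⟩

theorem discreteTopology_nonvanishing (hm : m ≠ 0) :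
    DiscreteTopology (analyticFunctions (nonvanishing m)) := by
  obtain ⟨x, hx⟩ := exists_trivial_point
  exact discreteTopology_analyticFunctions hx
    ((mem_nonvanishing_of_isPlaceOf hx).2 (Int.cast_ne_zero.2 hm))

/-- Evaluation at the trivial place is a uniformly continuous injection to a uniformly discrete
field. Such a ring is complete, so passing to series adds nothing. -/
theorem discreteUniformity_preSeries (hm : m ≠ 0) : DiscreteUniformity (PreSeries [0] m) := by
  obtain ⟨x, hx⟩ := exists_trivial_point
  have hxR : x.1 ∈ rationalTilde [0] m :=
    mem_rationalTilde (hx.mem_rationalDomain (by simp) hm)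
  let ev := (RingEquiv.toRingHom (valueEquiv hx isDenseModel_rat x.2.2)).comp
    ((Pi.evalRingHom (fun x : rationalTilde [0] m =>
      ValueRing x.1 (rationalTilde.functorial x.2)) ⟨x.1, hxR⟩).comp (PreSeries.toProd [0] m))
  have hc : Continuous ev := (continuous_valueEquiv hx isDenseModel_rat x.2.2).comp
    (PreSeries.continuous_coord [0] m ⟨x.1, hxR⟩)
  have hi : Function.Injective ev := (valueEquiv hx isDenseModel_rat x.2.2).injective.comp
    (hx.awayToValueRing_injective _ (hxR.1.2 m dvd_rfl))
  have hu : UniformContinuous ev := uniformContinuous_addMonoidHom_of_continuous hc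
  rw [discreteUniformity_iff_setRelId_mem_uniformity]
  filter_upwards [hu (DiscreteUniformity.relId_mem_uniformity (TrivNorm ℚ))] with p hp
  exact hi hp

theorem discreteTopology_analyticSeries (hm : m ≠ 0) :
    DiscreteTopology (AnalyticSeries [0] m) ∧
      Nonempty (AnalyticSeries [0] m ≃+* Localization.Away m) := by
  have hd := discreteUniformity_preSeries hm
  have hb : Function.Bijective
      (UniformSpace.Completion.coeRingHom : PreSeries [0] m →+* AnalyticSeries [0] m) := by
    refine ⟨UniformSpace.Completion.coe_injective _, fun z => ?_⟩
    have hcl := (UniformSpace.Completion.isUniformInducing_coe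
      (PreSeries [0] m)).isComplete_range.isClosed
    exact hcl.closure_subset (UniformSpace.Completion.denseRange_coe z)
  refine ⟨?_, ⟨(RingEquiv.ofBijective _ hb).symm⟩⟩
  exact (UniformSpace.Completion.UniformCompletion.completeEquivSelf
    (α := PreSeries [0] m)).toHomeomorph.symm.discreteTopology

end Nonvanishing

/-! ### Germs -/

section Germs

variable {A : Type*} [CommRing A] {x : SpehA A} {V : TopologicalSpace.Opens (SpehA A)}

/-- The direct limit over neighbourhoods is attained at the smallest one. -/
theorem germ_bijective_of_minimal (hxV : x ∈ V)
    (hV : ∀ U : TopologicalSpace.Opens (SpehA A), x ∈ U → V ≤ U) :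
    Function.Bijective ((analyticPresheaf A).germ (X := TopCat.of (SpehA A)) V x hxV) := by
  constructor
  · intro s t hst
    obtain ⟨W, hW, iU, iV, e⟩ := (analyticPresheaf A).germ_eq x hxV hxV s t hst
    obtain rfl : W = V := le_antisymm iU.le (hV W hW)
    exact e
  · intro t
    obtain ⟨U, hU, s, rfl⟩ := (analyticPresheaf A).exists_germ_eq t
    refine ⟨(analyticPresheaf A).map (CategoryTheory.homOfLE (hV U hU)).op s, ?_⟩
    exact (analyticPresheaf A).germ_res_apply (CategoryTheory.homOfLE (hV U hU)) x hxV s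

/-- The germs at a point with a smallest open neighbourhood are the analytic functions on it. -/
noncomputable def germsEquivOfMinimal (hxV : x ∈ V)
    (hV : ∀ U : TopologicalSpace.Opens (SpehA A), x ∈ U → V ≤ U) :
    AnalyticGerms x ≃+* analyticFunctions V :=
  (RingEquiv.ofBijective ((analyticPresheaf A).germ (X := TopCat.of (SpehA A)) V x hxV).hom
    (germ_bijective_of_minimal hxV hV)).symm

end Germs

/-- At an open point, germs are functions on that point, and by density of `ℤ[1/b]` every element of
the residue field is one. -/
theorem nonempty_germs_equiv_of_singleton {F : Type*} [NormedField F] [CompleteSpace F]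
    {x : SpehA ℤ} (h : IsPlaceOf x.1 F) (hF : IsDenseModel (Int.castRingHom F)) {l : List ℤ}
    {b : ℤ} (hx : rationalDomain l b = {x}) {g : Localization.Away b →+* F} (hg : DenseRange g) :
    Nonempty (AnalyticGerms x ≃+* F) := by
  classical
  have hxR : x ∈ rationalDomain l b := by rw [hx]; rfl
  let V : TopologicalSpace.Opens (SpehA ℤ) := ⟨rationalDomain l b, isOpen_rationalDomain l b⟩
  let e₁ := germsEquivOfMinimal (V := V) hxR fun U hU y hy => by
    have : y = x := Set.mem_singleton_iff.1 (hx ▸ hy)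
    rwa [this]
  let ev : analyticFunctions V →+* ResidueField x :=
    (Pi.evalRingHom (fun y : (V : Set (SpehA ℤ)) => ResidueField y.1) ⟨x, hxR⟩).comp
      (analyticFunctions V).subtype
  have hev : Function.Bijective ev := by
    constructor
    · intro f f' hff
      refine Subtype.ext (funext fun ⟨y, hy⟩ => ?_)
      obtain rfl : y = x := Set.mem_singleton_iff.1 (hx ▸ hy)
      exact hff
    · intro t
      refine ⟨⟨Function.update 0 ⟨x, hxR⟩ t, ?_⟩, Function.update_self _ _ _⟩
      exact isAnalyticOn_of_rationalDomain_eq_singleton hx (hxR.2 b dvd_rfl)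
        (denseRange_awayToValueRing h hF x.2.2 _ hg) rfl _
  exact ⟨(e₁.trans (RingEquiv.ofBijective ev hev)).trans (valueEquiv h hF x.2.2)⟩

/-! ### The archimedean place -/

theorem exists_ringHom_away {b : ℤ} {F : Type*} [Field F] (hb : (b : F) ≠ 0) :
    ∃ g : Localization.Away b →+* F, (b : F)⁻¹ ∈ g.range := by
  let g : Localization.Away b →+* F :=
    IsLocalization.Away.lift b (g := Int.castRingHom F) (isUnit_iff_ne_zero.2 hb)
  refine ⟨g, IsLocalization.Away.invSelf b, ?_⟩
  refine eq_inv_of_mul_eq_one_right ?_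
  have := congrArg g (IsLocalization.Away.mul_invSelf (S := Localization.Away b) b)
  simpa using this

theorem nonempty_germs_equiv_real {x : SpehA ℤ} (hx : IsPlaceOf x.1 ℝ) :
    Nonempty (AnalyticGerms x ≃+* ℝ) := by
  -- The condition is `1 < |2|`, which fails at all other places.
  have hxR : rationalDomain [1] 2 = {x} := by
    ext y
    rw [Set.mem_singleton_iff]
    constructor
    · intro hy
      have hy : y.1.InRational [1] 2 := hy
      rcases exists_isPlaceOf y.2 with h | h | ⟨p, hp, h | h⟩
      · have := (h.inRational_trivial_iff.1 hy).1 1 (by simp)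
        exact absurd this one_ne_zero
      · exact Subtype.ext (h.unique hx)
      · have := (h.inRational_iff.1 hy).1 1 (by simp)
        rw [Int.cast_one, norm_one] at this
        exact absurd this (Padic.norm_int_le_one 2).not_gt
      · have h1 := h.inRational_iff.1 hy
        have := h1.1 1 (by simp)
        rw [TrivNorm.norm_of_ne_zero h1.2, Int.cast_one, norm_one] at this
        exact absurd this (lt_irrefl 1)
    · rintro rfl
      exact hx.inRational_iff.2 (by simp)
  obtain ⟨g, c, hc⟩ := exists_ringHom_away (b := 2) (F := ℝ) (by simp)
  refine nonempty_germs_equiv_of_singleton hx isDenseModel_real hxR (g := g) ?_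
  have : Dense ((g.range.toAddSubgroup : AddSubgroup ℝ) : Set ℝ) := by
    -- The image of `ℤ[1/2]` contains the arbitrarily small positive numbers `2⁻ⁿ`.
    refine AddSubgroup.dense_of_not_isolated_zero _ fun ε hε => ?_
    obtain ⟨n, hn⟩ := exists_pow_lt_of_lt_one hε (show (2 : ℝ)⁻¹ < 1 by norm_num)
    refine ⟨(2 : ℝ)⁻¹ ^ n, ⟨c ^ n, ?_⟩, by positivity, hn⟩
    have hc' : g c = (2 : ℝ)⁻¹ := by simpa using hc
    exact (map_pow g c n).trans (by rw [hc'])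
  exact this

/-! ### The `p`-adic places -/

section Prime

variable {p : ℕ} [hp : Fact p.Prime]

theorem eq_of_norm_prime_lt_one {q : ℕ} [hq : Fact q.Prime] (h : ‖((p : ℤ) : ℚ_[q])‖ < 1) :
    q = p := by
  rw [Padic.norm_intCast_lt_one_iff, Int.natCast_dvd_natCast] at h
  exact (Nat.prime_dvd_prime_iff_eq hq.out hp.out).1 h

theorem nonempty_germs_equiv_padic {x : SpehA ℤ} (hx : IsPlaceOf x.1 ℚ_[p]) :
    Nonempty (AnalyticGerms x ≃+* ℚ_[p]) := by
  have hp0 : ((p : ℤ) : ℚ_[p]) ≠ 0 := by simpa using hp.out.ne_zero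
  -- The condition `|p ^ 2| < |p|` means `0 < |p| < 1`: non-vanishing excludes `|.|_{p,0}`, and the
  -- upper bound excludes the rest.
  have hxR : rationalDomain [(p : ℤ) ^ 2] p = {x} := by
    ext y
    rw [Set.mem_singleton_iff]
    constructor
    · intro hy
      have hy : y.1.InRational [(p : ℤ) ^ 2] p := hy
      rcases exists_isPlaceOf y.2 with h | h | ⟨q, hq, h | h⟩
      · have := (h.inRational_trivial_iff.1 hy).1 _ (List.mem_singleton_self _)
        simp [hp.out.ne_zero] at this
      · have := (h.inRational_iff.1 hy).1 _ (List.mem_singleton_self _)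
        have h1 : (1 : ℝ) < p := by exact_mod_cast hp.out.one_lt
        simp only [Int.cast_pow, Int.cast_natCast, norm_pow, RCLike.norm_natCast] at this
        nlinarith
      · have h1 := h.inRational_iff.1 hy
        have h2 := h1.1 _ (List.mem_singleton_self _)
        rw [Int.cast_pow, norm_pow, sq] at h2
        have h3 : ‖((p : ℤ) : ℚ_[q])‖ < 1 :=
          (mul_lt_iff_lt_one_left (norm_pos_iff.2 h1.2)).1 h2
        obtain rfl := eq_of_norm_prime_lt_one h3
        exact Subtype.ext (h.unique hx)
      · have h1 := h.inRational_iff.1 hy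
        have h2 := h1.1 _ (List.mem_singleton_self _)
        rw [Int.cast_pow, norm_pow, TrivNorm.norm_of_ne_zero h1.2, one_pow] at h2
        exact absurd h2 (lt_irrefl 1)
    · rintro rfl
      refine hx.inRational_iff.2 ⟨fun a ha => ?_, hp0⟩
      obtain rfl := List.mem_singleton.1 ha
      rw [Int.cast_pow, norm_pow, sq]
      exact mul_lt_of_lt_one_left (norm_pos_iff.2 hp0)
        (Padic.norm_intCast_lt_one_iff.2 dvd_rfl)
  obtain ⟨g, hg⟩ := exists_ringHom_away hp0
  refine nonempty_germs_equiv_of_singleton hx (isDenseModel_padic p) hxR (g := g) fun t => ?_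
  have hcoe : Continuous fun w : ℤ_[p] => (w : ℚ_[p]) := continuous_subtype_val
  have hint : ∀ w : ℤ_[p], (w : ℚ_[p]) ∈ g.range.topologicalClosure := fun w => by
    refine PadicInt.denseRange_intCast.induction_on w
      (g.range.isClosed_topologicalClosure.preimage hcoe) fun n => ?_
    exact g.range.le_topologicalClosure ⟨n, by simp⟩
  have hinv : ((p : ℤ) : ℚ_[p])⁻¹ ∈ g.range.topologicalClosure :=
    g.range.le_topologicalClosure hg
  -- This `n` makes `t * p ^ n` a `p`-adic integer. The closure of `ℤ[1/p]` is a ring containing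
  -- `ℤ_[p]` and `p⁻¹`, hence also `t`.
  obtain ⟨n, hn⟩ := exists_pow_lt_of_lt_one
    (show (0 : ℝ) < (‖t‖ + 1)⁻¹ by positivity) (Padic.norm_p_lt_one (p := p))
  have ht : ‖t * (p : ℚ_[p]) ^ n‖ ≤ 1 := by
    rw [norm_mul, norm_pow]
    have h1 : ‖t‖ * (‖t‖ + 1)⁻¹ ≤ 1 := by
      rw [← div_eq_mul_inv, div_le_one (by positivity)]
      linarith
    exact (mul_le_mul_of_nonneg_left hn.le (norm_nonneg t)).trans h1
  have h2 : t = ((⟨_, ht⟩ : ℤ_[p]) : ℚ_[p]) * (((p : ℤ) : ℚ_[p])⁻¹) ^ n := by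
    have hp0' : (p : ℚ_[p]) ≠ 0 := by exact_mod_cast hp0
    change t = t * (p : ℚ_[p]) ^ n * _
    push_cast
    rw [inv_pow, mul_assoc, mul_inv_cancel₀ (pow_ne_zero _ hp0'), mul_one]
  have h3 : t ∈ g.range.topologicalClosure := by
    rw [h2]
    exact mul_mem (hint _) (pow_mem hinv n)
  exact h3

/-! ### The residual places -/

/-- The open set `{|p| < 1}` is the smallest neighbourhood of `|.|_{p,0}`, since each neighbourhood
of this point contains `|.|_p`. -/
theorem rationalDomain_prime_eq {x y : SpehA ℤ} (hx : IsPlaceOf x.1 (TrivNorm (ZMod p)))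
    (hy : IsPlaceOf y.1 ℚ_[p]) : rationalDomain [(p : ℤ)] 1 = {x, y} := by
  have hxR : x.1.InRational [(p : ℤ)] 1 := by
    refine hx.inRational_iff.2 ⟨fun a ha => ?_, by simp⟩
    obtain rfl := List.mem_singleton.1 ha
    have : ((p : ℤ) : TrivNorm (ZMod p)) = 0 := by
      apply (WithAbs.equiv _).injective
      simp
    rw [this, norm_zero, Int.cast_one, norm_one]
    exact one_pos
  ext z
  rw [Set.mem_insert_iff, Set.mem_singleton_iff]
  constructor
  · intro hz
    have hz : z.1.InRational [(p : ℤ)] 1 := hz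
    rcases exists_isPlaceOf z.2 with h | h | ⟨q, hq, h | h⟩
    · have := (h.inRational_trivial_iff.1 hz).1 _ (List.mem_singleton_self _)
      simp [hp.out.ne_zero] at this
    · have := (h.inRational_iff.1 hz).1 _ (List.mem_singleton_self _)
      have h1 : (1 : ℝ) < p := by exact_mod_cast hp.out.one_lt
      rw [Int.cast_one, norm_one, Int.cast_natCast, RCLike.norm_natCast] at this
      linarith
    · have h2 := (h.inRational_iff.1 hz).1 _ (List.mem_singleton_self _)
      rw [Int.cast_one, norm_one] at h2
      obtain rfl := eq_of_norm_prime_lt_one h2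
      exact Or.inr (Subtype.ext (h.unique hy))
    · have h2 := (h.inRational_iff.1 hz).1 _ (List.mem_singleton_self _)
      rw [Int.cast_one, norm_one] at h2
      obtain rfl :=
        eq_of_norm_prime_lt_one (padic_norm_intCast_lt_one (TrivNorm.eq_zero_of_norm_lt_one h2))
      exact Or.inl (Subtype.ext (h.unique hx))
  · rintro (rfl | rfl)
    · exact hxR
    · exact hx.inRational_padic hy hxR

theorem exists_family_of_ne {ι : Type*} {M : ι → Type*} [∀ i, Zero (M i)] {i j : ι} (hij : i ≠ j)
    (a : M i) (b : M j) : ∃ f : ∀ k, M k, f i = a ∧ f j = b := by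
  classical
  exact ⟨Function.update (Function.update 0 i a) j b,
    by rw [Function.update_of_ne hij, Function.update_self], Function.update_self _ _ _⟩

/-- Germs are functions on the two points of `{|p| < 1}`. Such a function is a `p`-adic integer
together with its reduction; conversely each such pair is a limit of integers. -/
theorem nonempty_germs_equiv_padicInt {x : SpehA ℤ} (hx : IsPlaceOf x.1 (TrivNorm (ZMod p))) :
    Nonempty (AnalyticGerms x ≃+* ℤ_[p]) := by
  obtain ⟨y, hy⟩ := exists_padic_point p
  have hR := rationalDomain_prime_eq hx hy
  have hxR : x ∈ rationalDomain [(p : ℤ)] 1 := by rw [hR]; exact Or.inl rfl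
  have hyR : y ∈ rationalDomain [(p : ℤ)] 1 := by rw [hR]; exact Or.inr rfl
  have hxy : x ≠ y := by
    rintro rfl
    have h1 : ((p : ℤ) : TrivNorm (ZMod p)) = 0 := by
      apply (WithAbs.equiv _).injective
      simp
    rw [← eq_intCast (Int.castRingHom (TrivNorm (ZMod p))), ← hx.eq_zero_iff, hy.eq_zero_iff] at h1
    simp [hp.out.ne_zero] at h1
  let V : TopologicalSpace.Opens (SpehA ℤ) :=
    ⟨rationalDomain [(p : ℤ)] 1, isOpen_rationalDomain _ _⟩
  let e₁ := germsEquivOfMinimal (V := V) hxR fun U hU z hz => by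
    have hz : z ∈ ({x, y} : Set (SpehA ℤ)) := hR ▸ hz
    rcases hz with rfl | rfl
    · exact hU
    · exact hx.mem_of_isOpen hy U.isOpen hU
  let ex := valueEquiv hx (isDenseModel_zmod p) x.2.2
  let ey := valueEquiv hy (isDenseModel_padic p) y.2.2
  have hspec : ∀ f : analyticFunctions V, ∃ w : ℤ_[p],
      ey (f.1 ⟨y, hyR⟩) = w ∧ ex (f.1 ⟨x, hxR⟩) = padicReduction p w :=
    fun f => IsAnalyticOn.exists_padicInt hx hy f.2 hxR hyR
  let ev : analyticFunctions V →+* ℚ_[p] := (RingEquiv.toRingHom ey).comp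
    ((Pi.evalRingHom (fun z : (V : Set (SpehA ℤ)) => ResidueField z.1) ⟨y, hyR⟩).comp
      (analyticFunctions V).subtype)
  let ρ : analyticFunctions V →+* ℤ_[p] := ev.codRestrict (PadicInt.subring p) fun f => by
    obtain ⟨w, hw, -⟩ := hspec f
    change ‖ey (f.1 ⟨y, hyR⟩)‖ ≤ 1
    rw [hw]
    exact w.2
  have hρ : ∀ f, (ρ f : ℚ_[p]) = ey (f.1 ⟨y, hyR⟩) := fun f => rfl
  have hρ' : ∀ f, ex (f.1 ⟨x, hxR⟩) = padicReduction p (ρ f) := fun f => by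
    obtain ⟨w, hw, hw'⟩ := hspec f
    have : ρ f = w := Subtype.ext ((hρ f).trans hw)
    rw [hw', this]
  have hcases : ∀ z : (V : Set (SpehA ℤ)), z = ⟨x, hxR⟩ ∨ z = ⟨y, hyR⟩ := fun z => by
    have hz : z.1 ∈ ({x, y} : Set (SpehA ℤ)) := hR ▸ z.2
    rcases hz with h | h
    · exact Or.inl (Subtype.ext h)
    · exact Or.inr (Subtype.ext h)
  refine ⟨e₁.trans (RingEquiv.ofBijective ρ ⟨fun f f' hff => ?_, fun w => ?_⟩)⟩
  · refine Subtype.ext (funext fun z => ?_)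
    rcases hcases z with rfl | rfl
    · exact ex.injective ((hρ' f).trans ((congrArg _ hff).trans (hρ' f').symm))
    · exact ey.injective ((hρ f).symm.trans ((congrArg Subtype.val hff).trans (hρ f')))
  · have hne : (⟨x, hxR⟩ : (V : Set (SpehA ℤ))) ≠ ⟨y, hyR⟩ :=
      fun h => hxy (congrArg Subtype.val h)
    -- `F w` is the family with values `w` and its reduction. It depends continuously on `w` and is
    -- the constant family `n` at an integer `n`, so density of `ℤ` in `ℤ_[p]` puts it in the
    -- closure.
    choose F hFx hFy using fun w : ℤ_[p] =>
      exists_family_of_ne (M := fun z : (V : Set (SpehA ℤ)) => ResidueField z.1) hne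
        (ex.symm (padicReduction p w)) (ey.symm (w : ℚ_[p]))
    have hFc : Continuous F := by
      refine continuous_pi fun z => ?_
      rcases hcases z with rfl | rfl
      · simp only [hFx]
        exact (isHomeomorph_valueEquiv hx (isDenseModel_zmod p) x.2.2).homeomorph.symm.continuous
          |>.comp (continuous_padicReduction p)
      · simp only [hFy]
        exact (isHomeomorph_valueEquiv hy (isDenseModel_padic p) y.2.2).homeomorph.symm.continuous
          |>.comp continuous_subtype_val
    have hFn : ∀ n : ℤ, F n = n := fun n => funext fun z => by
      rcases hcases z with rfl | rfl
      · rw [hFx, map_intCast, map_intCast, Pi.intCast_apply]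
      · rw [hFy, PadicInt.coe_intCast, map_intCast, Pi.intCast_apply]
    have hFa : ∀ w, IsAnalyticOn (V : Set (SpehA ℤ)) (F w) := fun w =>
      isAnalyticOn_iff_closure.2 fun x₀ hx₀ => ⟨_, _, le_rfl, hx₀, by
        have hc : Continuous fun w => restrictTilde (F w) (le_refl (V : Set (SpehA ℤ))) :=
          continuous_pi fun z => (continuous_apply _).comp hFc
        refine PadicInt.denseRange_intCast.induction_on
          (p := fun w => restrictTilde (F w) (le_refl (V : Set (SpehA ℤ))) ∈ closure _) w
          (isClosed_closure.preimage hc) fun n => ?_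
        rw [hFn]
        exact subset_closure ⟨n, map_intCast _ n⟩⟩
    refine ⟨⟨F w, hFa w⟩, Subtype.ext ?_⟩
    rw [hρ]
    change ey (F w ⟨y, hyR⟩) = _
    rw [hFy, RingEquiv.apply_symm_apply]

end Prime

/-! ### Germs at the trivial place -/

/-- Clearing the denominator gives an identity valid on all of `U`, so identifying the germ requires
no smaller neighbourhood. -/
theorem mul_den_evalTrivial {x : SpehA ℤ} (hx : IsPlaceOf x.1 (TrivNorm ℚ))
    {U : TopologicalSpace.Opens (SpehA ℤ)} (hU : x ∈ U) (f : analyticFunctions U) :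
    f * (((evalTrivial hx hU f).den : ℤ) : analyticFunctions U) =
      ((evalTrivial hx hU f).num : ℤ) := by
  apply evalTrivial_injective hx hU
  rw [map_mul, map_intCast, map_intCast]
  exact_mod_cast Rat.mul_den_eq_num _

/-- This point is treated through the universal property of `ℚ` instead of a minimal neighbourhood:
a non-zero `n` is invertible on `nonvanishing n`, so `ℚ` maps to the germs, injectively because
these are non-trivial. A germ `f` with rational value `s` satisfies `f * s.den = s.num`, which gives
surjectivity. -/
theorem nonempty_germs_equiv_rat {x : SpehA ℤ} (hx : IsPlaceOf x.1 (TrivNorm ℚ)) :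
    Nonempty (AnalyticGerms x ≃+* ℚ) := by
  let germ : ∀ (U : TopologicalSpace.Opens (SpehA ℤ)), x ∈ U →
      (analyticFunctions U →+* AnalyticGerms x) := fun U hU =>
    ((analyticPresheaf ℤ).germ (X := TopCat.of (SpehA ℤ)) U x hU).hom
  have hunit : ∀ n : nonZeroDivisors ℤ, IsUnit (Int.castRingHom (AnalyticGerms x) n) := fun n => by
    have hn : (n : ℤ) ≠ 0 := nonZeroDivisors.ne_zero n.2
    have h1 : IsUnit (algebraMap ℤ (Localization.Away (n : ℤ)) n) :=
      IsLocalization.Away.algebraMap_isUnit _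
    have h2 := (h1.map (awayToAnalytic (n : ℤ))).map
      (germ _ ((mem_nonvanishing_of_isPlaceOf hx).2 (Int.cast_ne_zero.2 hn)))
    have h3 : ∀ m : ℤ, germ _ ((mem_nonvanishing_of_isPlaceOf hx).2 (Int.cast_ne_zero.2 hn))
        (awayToAnalytic (n : ℤ) (algebraMap ℤ (Localization.Away (n : ℤ)) m)) = m := fun m => by
      rw [eq_intCast, map_intCast (awayToAnalytic (n : ℤ))]
      exact map_intCast _ _
    exact (congrArg IsUnit (h3 n)).mp h2
  let φ : ℚ →+* AnalyticGerms x := IsLocalization.lift (M := nonZeroDivisors ℤ) hunit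
  have hnt : Nontrivial (AnalyticGerms x) := by
    refine ⟨⟨1, 0, fun h => ?_⟩⟩
    have h1 : germ ⊤ trivial 1 = germ ⊤ trivial 0 :=
      (map_one (germ ⊤ trivial)).trans (h.trans (map_zero (germ ⊤ trivial)).symm)
    obtain ⟨W, hW, iU, iV, e⟩ := (analyticPresheaf ℤ).germ_eq x _ _ _ _ h1
    have h2 : (1 : ResidueField x) = 0 := by
      have e : (1 : analyticFunctions W) = 0 := e
      exact congrFun (congrArg Subtype.val e) ⟨x, hW⟩
    have h3 := congrArg (valueEquiv hx isDenseModel_rat x.2.2) h2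
    rw [RingEquiv.map_one, RingEquiv.map_zero] at h3
    exact one_ne_zero h3
  refine ⟨(RingEquiv.ofBijective φ ⟨φ.injective, fun t => ?_⟩).symm⟩
  obtain ⟨U, hU, f, rfl⟩ := (analyticPresheaf ℤ).exists_germ_eq t
  set s : ℚ := evalTrivial hx hU f with hs
  have hmul : ∀ (f : analyticFunctions U) (d n : ℤ), f * (d : analyticFunctions U) = n →
      germ U hU f * (d : AnalyticGerms x) = n := fun f d n h => by
    have := congrArg (germ U hU) h
    rwa [map_mul, map_intCast, map_intCast] at this
  have hf := hmul f _ _ (mul_den_evalTrivial hx hU f)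
  have hφ : φ s * ((s.den : ℤ) : AnalyticGerms x) = ((s.num : ℤ) : AnalyticGerms x) := by
    rw [← map_intCast φ, ← map_intCast φ, ← map_mul]
    congr 1
    exact_mod_cast Rat.mul_den_eq_num s
  have hu : IsUnit ((s.den : ℤ) : AnalyticGerms x) :=
    hunit ⟨(s.den : ℤ), mem_nonZeroDivisors_of_ne_zero (by exact_mod_cast s.den_ne_zero)⟩
  exact ⟨s, hu.mul_right_cancel (hφ.trans hf.symm)⟩

/-! ### The analytic spectrum of `ℤ` -/

theorem isHomeomorph_trivNorm_equiv {K : Type*} [Field K] [TopologicalSpace K]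
    [DiscreteTopology K] : IsHomeomorph (WithAbs.equiv _ : TrivNorm K ≃+* K) :=
  (Equiv.toHomeomorphOfDiscrete (WithAbs.equiv _ : TrivNorm K ≃+* K).toEquiv).isHomeomorph

theorem mainTheorem5 :
    -- the analytic and the multiplicative harmonious spectrum of `ℤ` coincide, with their points
    SpehA ℤ = SpehM ℤ ∧
    SpehA ℤ = {trivialPlace, archPlace} ∪
      {x | ∃ (p : ℕ) (_ : Fact p.Prime), x = padicPlace p ∨ x = residualPlace p} ∧
    -- residue fields (as topological rings) and germs of analytic functions
    (∀ (p : ℕ) [Fact p.Prime] (x : SpehA ℤ), x.1 = residualPlace p →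
      (∃ e : ResidueField x ≃+* ZMod p, IsHomeomorph e) ∧
      Nonempty (AnalyticGerms x ≃+* ℤ_[p])) ∧
    (∀ (p : ℕ) [Fact p.Prime] (x : SpehA ℤ), x.1 = padicPlace p →
      (∃ e : ResidueField x ≃+* ℚ_[p], IsHomeomorph e) ∧
      Nonempty (AnalyticGerms x ≃+* ℚ_[p])) ∧
    (∀ x : SpehA ℤ, x.1 = archPlace →
      (∃ e : ResidueField x ≃+* ℝ, IsHomeomorph e) ∧
      Nonempty (AnalyticGerms x ≃+* ℝ)) ∧
    (∀ x : SpehA ℤ, x.1 = trivialPlace →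
      (DiscreteTopology (ResidueField x) ∧ Nonempty (ResidueField x ≃+* ℚ)) ∧
      Nonempty (AnalyticGerms x ≃+* ℚ)) ∧
    -- sections on `{x | 0 < |m(x)|}`, also as analytic series on the rational domain `R(0 / m)`
    (∀ m : ℤ, m ≠ 0 →
      (DiscreteTopology (analyticFunctions (nonvanishing m)) ∧
        Nonempty (analyticFunctions (nonvanishing m) ≃+* Localization.Away m)) ∧
      (DiscreteTopology (AnalyticSeries [0] m) ∧
        Nonempty (AnalyticSeries [0] m ≃+* Localization.Away m))) ∧
    -- global sections
    (DiscreteTopology (analyticFunctions (⊤ : TopologicalSpace.Opens (SpehA ℤ))) ∧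
      Nonempty (analyticFunctions (⊤ : TopologicalSpace.Opens (SpehA ℤ)) ≃+* ℤ)) := by
  refine ⟨SpehA_int_eq_SpehM, ?_, fun p _ x hx => ?_, fun p _ x hx => ?_, fun x hx => ?_,
    fun x hx => ?_, fun m hm => ?_, ?_⟩
  · ext x
    rw [SpehA_int_eq_SpehM, mem_SpehM_int_iff, ← or_assoc]
    rfl
  · rw [Place.residualPlace_eq, Place.eq_ofField_iff] at hx
    refine ⟨⟨(valueEquiv hx (isDenseModel_zmod p) x.2.2).trans (WithAbs.equiv _), ?_⟩,
      nonempty_germs_equiv_padicInt hx⟩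
    exact isHomeomorph_trivNorm_equiv.comp
      (isHomeomorph_valueEquiv hx (isDenseModel_zmod p) x.2.2)
  · rw [Place.padicPlace_eq, Place.eq_ofField_iff] at hx
    exact ⟨⟨valueEquiv hx (isDenseModel_padic p) x.2.2, isHomeomorph_valueEquiv hx _ _⟩,
      nonempty_germs_equiv_padic hx⟩
  · rw [Place.archPlace_eq, Place.eq_ofField_iff] at hx
    exact ⟨⟨valueEquiv hx isDenseModel_real x.2.2, isHomeomorph_valueEquiv hx _ _⟩,
      nonempty_germs_equiv_real hx⟩
  · rw [Place.trivialPlace_eq, Place.eq_ofField_iff] at hx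
    exact ⟨⟨IsPlaceOf.discreteTopology hx x.2.2,
      ⟨(valueEquiv hx isDenseModel_rat x.2.2).trans (WithAbs.equiv _)⟩⟩,
      nonempty_germs_equiv_rat hx⟩
  · exact ⟨⟨discreteTopology_nonvanishing hm,
      ⟨(RingEquiv.ofBijective _ (awayToAnalytic_bijective hm)).symm⟩⟩,
      discreteTopology_analyticSeries hm⟩
  · have h : (⊤ : TopologicalSpace.Opens (SpehA ℤ)) = nonvanishing 1 := by
      refine (top_unique fun x _ => mem_nonvanishing.2 ?_).symm
      rw [x.1.norm.map_one]
      exact one_ne_zero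
    rw [h]
    exact ⟨discreteTopology_nonvanishing one_ne_zero,
      ⟨(RingEquiv.ofBijective _ (awayToAnalytic_bijective one_ne_zero)).symm.trans
        (IsLocalization.atOne ℤ (Localization.Away (1 : ℤ))).symm.toRingEquiv⟩⟩
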